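/- Let $d\ge 1$ and let $\Gamma\subset\mathrm{Isom}(\mathbb R^d)$ be a splitting crystal group: $\Gamma$ is discrete in the topology of pointwise convergence; it has a compact fundamental domain, i.e. a compact set $P$ such that $\bigcup_{\gamma\in\Gamma}\gamma(P)=\mathbb R^d$ and, for $\gamma,\gamma'\in\Gamma$, $\gamma(P^\circ)\cap\gamma'(P^\circ)\ne\emptyset$ implies $\gamma=\gamma'$; and $\Gamma$ is the semidirect product of its translation lattice $\Lambda=\{k\in\mathbb R^d: (x\mapsto x+k)\in\Gamma\}$ and its (finite) point group $G\subset \mathbf O(d)$, the group of linear parts of elements of $\Gamma$; that is, $\Gamma$ consists of the maps $x\mapsto g(x+k)$ with $g\in G$, $k\in\Lambda$. Put $r=|G|$ and let $|L|$ be the volume of a fundamental domain $L$ of the lattice $\Lambda$. Let $a$ be a $\Gamma$-admissible matrix, i.e. a real $d\times d$ matrix all of whose (complex) eigenvalues have modulus larger than $1$ and such that $a\Gamma a^{-1}\subset\Gamma$. For an invertible affine map $T$ of $\mathbb R^d$ let $D_Tf(x)=|\det \mathrm{lin}(T)|^{-1/2}f(T^{-1}x)$ on $L^2(\mathbb R^d)=L^2(\mathbb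 R^d,\mathbb C)$, where $\mathrm{lin}(T)$ is the linear part of $T$, and let $\widehat f(\omega)=\int_{\mathbb R^d}e^{-2\pi i x\cdot\omega}f(x)\,dx$. Let $\phi\in L^2(\mathbb R^d)$ be compactly supported with orthonormal $\Gamma$-translates, i.e. $\langle D_\gamma\phi,D_\sigma\phi\rangle=\delta_{\gamma,\sigma}$ for all $\gamma,\sigma\in\Gamma$. Let $\mathcal V_0=\overline{\mathrm{span}}\{D_\gamma\phi:\gamma\in\Gamma\}$ and $\mathcal V_j=\{f(a^jx): f\in\mathcal V_0\}$ for $j\in\mathbb Z$. Say that $\phi$ is $\Gamma$-refinable if there are a finite set $\Gamma'\subset\Gamma$ and scalars $d_\gamma\in\mathbb C$ such that $$\phi(x)=\sum_{\gamma\in\Gamma'}d_\gamma\,(D_\gamma\phi)(ax)\quad\text{for a.e. }x\in\mathbb R^d .$$ Then the following hold. 1. Every $\mathcal V_j$ is a closed subspace of $L^2(\mathbb R^d)$; $\mathcal V_{j+1}=D_a^{-1}\mathcal V_j$ for all $j\in\mathbb Z$; $\{D_\gamma\phi:\gamma\in\Gamma\}$ is an orthonormal basis of $\mathcal V_0$;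 and $\bigcap_{j\in\mathbb Z}\mathcal V_j=\{0\}$. 2. $\mathcal V_j\subset\mathcal V_{j+1}$ for all $j\in\mathbb Z$ if and only if $\phi$ is $\Gamma$-refinable. 3. If $|\widehat\phi(0)|^2=|L|/r$, then $\bigcup_{j\in\mathbb Z}\mathcal V_j$ is dense in $L^2(\mathbb R^d)$. Moreover, if $\phi$ is $\Gamma$-refinable, then $\bigcup_{j\in\mathbb Z}\mathcal V_j$ is dense in $L^2(\mathbb R^d)$ if and only if $|\widehat\phi(0)|^2=|L|/r$. -/

import Mathlib

open MeasureTheory Topology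
open scoped ENNReal

noncomputable section

namespace CrystalMRA

/-- Euclidean space `ℝ^d`. -/
abbrev Space (d : ℕ) : Type := EuclideanSpace ℝ (Fin d)

/-- The isometry group of `ℝ^d` (every isometry of `ℝ^d` onto itself is affine). -/
abbrev Isom (d : ℕ) : Type := Space d ≃ᵃⁱ[ℝ] Space d

/-- The complex Hilbert space `L²(ℝ^d)` with respect to Lebesgue measure. -/
abbrev L2 (d : ℕ) : Type := Lp ℂ 2 (volume : Measure (Space d))

/-! ### Crystal groups -/

/-- A crystal group: a subgroup of `Isom(ℝ^d)`, discrete in the topology of pointwise convergence,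
that has a compact fundamental domain. -/
structure IsCrystalGroup {d : ℕ} (Γ : Subgroup (Isom d)) : Prop where
  /-- The type `Space d → Space d` carries the product topology, i.e. that of pointwise
  convergence. -/
  discrete : DiscreteTopology {f : Space d → Space d | ∃ γ ∈ Γ, f = γ}
  exists_fundamentalDomain : ∃ P : Set (Space d), IsCompact P ∧
    (⋃ γ ∈ Γ, γ '' P) = Set.univ ∧
    ∀ γ ∈ Γ, ∀ γ' ∈ Γ, ((γ '' interior P) ∩ (γ' '' interior P)).Nonempty → γ = γ'

/-- The lattice `Λ` of the vectors `k` such that the translation by `k` belongs to `Γ`. -/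
def lattice {d : ℕ} (Γ : Subgroup (Isom d)) : Submodule ℤ (Space d) :=
  AddSubgroup.toIntSubmodule
    { carrier := {k | AffineIsometryEquiv.constVAdd ℝ (Space d) k ∈ Γ}
      zero_mem' := by
        have h : AffineIsometryEquiv.constVAdd ℝ (Space d) 0 = 1 := by
          ext1 x
          simp
        change AffineIsometryEquiv.constVAdd ℝ (Space d) 0 ∈ Γ
        exact h.symm ▸ Γ.one_mem
      add_mem' := by
        intro k l hk hl
        have h : AffineIsometryEquiv.constVAdd ℝ (Space d) (k + l) =
            AffineIsometryEquiv.constVAdd ℝ (Space d) k *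
              AffineIsometryEquiv.constVAdd ℝ (Space d) l := by
          ext1 x
          simp [add_assoc]
        simpa [h] using Γ.mul_mem hk hl
      neg_mem' := by
        intro k hk
        have h : AffineIsometryEquiv.constVAdd ℝ (Space d) (-k) =
            (AffineIsometryEquiv.constVAdd ℝ (Space d) k)⁻¹ := by
          rw [eq_inv_iff_mul_eq_one]
          ext1 x
          simp
        simpa [h] using Γ.inv_mem hk }

/-- The point group `G` of `Γ`: the group of the linear parts of the elements of `Γ`. -/
def pointGroup {d : ℕ} (Γ : Subgroup (Isom d)) : Subgroup (Space d ≃ₗᵢ[ℝ] Space d) where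
  carrier := {g | ∃ γ ∈ Γ, γ.linearIsometryEquiv = g}
  one_mem' := ⟨1, Γ.one_mem, rfl⟩
  mul_mem' := by
    rintro _ _ ⟨γ, hγ, rfl⟩ ⟨σ, hσ, rfl⟩
    exact ⟨γ * σ, Γ.mul_mem hγ hσ, rfl⟩
  inv_mem' := by
    rintro _ ⟨γ, hγ, rfl⟩
    exact ⟨γ⁻¹, Γ.inv_mem hγ, rfl⟩

/-- A splitting crystal group: `Γ` contains its point group `G` (as isometries fixing the origin).
Equivalently `Γ` is the semidirect product of its subgroups `Λ` and `G`, that is, `Γ` consists of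
the maps `x ↦ g (x + k)` with `g ∈ G` and `k ∈ Λ`. -/
structure IsSplittingCrystalGroup {d : ℕ} (Γ : Subgroup (Isom d)) : Prop
    extends IsCrystalGroup Γ where
  split : ∀ g ∈ pointGroup Γ, g.toAffineIsometryEquiv ∈ Γ

/-! ### Matrices acting on `ℝ^d` -/

/-- The linear automorphism `x ↦ a x` of `ℝ^d` given by an invertible matrix, as an affine map. -/
def matAff {d : ℕ} (a : GL (Fin d) ℝ) : Space d ≃ᵃ[ℝ] Space d :=
  (LinearMap.GeneralLinearGroup.generalLinearEquiv ℝ (Space d)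
    (Units.map (Matrix.toLpLinAlgEquiv (R := ℝ) (n := Fin d) 2 :
      Matrix (Fin d) (Fin d) ℝ →* Module.End ℝ (Space d)) a)).toAffineEquiv

/-- A `Γ`-admissible matrix: an expanding matrix `a` (all complex eigenvalues have modulus larger
than `1`) with `a Γ a⁻¹ ⊆ Γ`. -/
structure IsAdmissible {d : ℕ} (Γ : Subgroup (Isom d)) (a : GL (Fin d) ℝ) : Prop where
  expanding : ∀ z ∈ spectrum ℂ ((a : Matrix (Fin d) (Fin d) ℝ).map (algebraMap ℝ ℂ)), 1 < ‖z‖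
  conj_mem : ∀ γ ∈ Γ, ∃ γ' ∈ Γ, ∀ x : Space d, γ' x = matAff a (γ (matAff a⁻¹ x))

/-! ### The operators on `L²(ℝ^d)` -/

/-- An affine automorphism of `ℝ^d` maps Lebesgue measure to a multiple of Lebesgue measure. -/
theorem measurePreserving_affine {d : ℕ} (T : Space d ≃ᵃ[ℝ] Space d) :
    MeasurePreserving T volume
      (ENNReal.ofReal |(LinearMap.det (T.linear : Space d →ₗ[ℝ] Space d))⁻¹| • volume) := by
  have hT : (T : Space d → Space d) =
      (fun y => y + T 0) ∘ (T.linear : Space d →ₗ[ℝ] Space d) := by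
    funext x
    have := T.map_vadd 0 x
    simpa using this
  have hlin : Continuous (T.linear : Space d →ₗ[ℝ] Space d) :=
    LinearMap.continuous_of_finiteDimensional _
  have hdet : LinearMap.det (T.linear : Space d →ₗ[ℝ] Space d) ≠ 0 :=
    (LinearEquiv.isUnit_det' T.linear).ne_zero
  rw [hT]
  refine MeasurePreserving.comp (μb := ENNReal.ofReal
    |(LinearMap.det (T.linear : Space d →ₗ[ℝ] Space d))⁻¹| • volume) ?_ ⟨hlin.measurable, ?_⟩
  · exact (measurePreserving_add_right volume (T 0)).smul_measure _
  · exact Measure.map_linearMap_addHaar_eq_smul_addHaar volume hdet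

theorem quasiMeasurePreserving_affine {d : ℕ} (T : Space d ≃ᵃ[ℝ] Space d) :
    Measure.QuasiMeasurePreserving T (volume : Measure (Space d)) volume :=
  ⟨(measurePreserving_affine T).measurable, by
    rw [(measurePreserving_affine T).map_eq]
    exact Measure.smul_absolutelyContinuous⟩

theorem memLp_comp_affine {d : ℕ} (T : Space d ≃ᵃ[ℝ] Space d) (f : L2 d) :
    MemLp (fun x => f (T x)) 2 (volume : Measure (Space d)) :=
  ((Lp.memLp f).smul_measure ENNReal.ofReal_ne_top).comp_measurePreserving
    (measurePreserving_affine T)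

theorem toLp_comp_comp {d : ℕ} (T S : Space d ≃ᵃ[ℝ] Space d) (hTS : ∀ x, T (S x) = x) (f : L2 d) :
    (memLp_comp_affine S ((memLp_comp_affine T f).toLp _)).toLp _ = f := by
  ext1
  filter_upwards [MemLp.coeFn_toLp (memLp_comp_affine S ((memLp_comp_affine T f).toLp _)),
    (quasiMeasurePreserving_affine S).ae (MemLp.coeFn_toLp (memLp_comp_affine T f))] with x h1 h2
  rw [h1, h2, hTS]

/-- Composition with an affine automorphism `T`, that is `f ↦ f ∘ T`, on `L²(ℝ^d)`. -/
def compL2 {d : ℕ} (T : Space d ≃ᵃ[ℝ] Space d) : L2 d ≃ₗ[ℂ] L2 d where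
  toFun f := (memLp_comp_affine T f).toLp _
  map_add' f g := by
    ext1
    filter_upwards [MemLp.coeFn_toLp (memLp_comp_affine T (f + g)),
      Lp.coeFn_add ((memLp_comp_affine T f).toLp _) ((memLp_comp_affine T g).toLp _),
      MemLp.coeFn_toLp (memLp_comp_affine T f), MemLp.coeFn_toLp (memLp_comp_affine T g),
      (quasiMeasurePreserving_affine T).ae (Lp.coeFn_add f g)] with x h1 h2 h3 h4 h5
    rw [h1, h2, h5]
    simp only [Pi.add_apply, h3, h4]
  map_smul' c f := by
    ext1
    filter_upwards [MemLp.coeFn_toLp (memLp_comp_affine T (c • f)),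
      Lp.coeFn_smul c ((memLp_comp_affine T f).toLp _),
      MemLp.coeFn_toLp (memLp_comp_affine T f),
      (quasiMeasurePreserving_affine T).ae (Lp.coeFn_smul c f)] with x h1 h2 h3 h4
    rw [h1, RingHom.id_apply, h2, h4]
    simp only [Pi.smul_apply, h3]
  invFun f := (memLp_comp_affine T.symm f).toLp _
  left_inv f := toLp_comp_comp T T.symm T.apply_symm_apply f
  right_inv f := toLp_comp_comp T.symm T T.symm_apply_apply f

/-- The operator `D_T f (x) = |det (lin T)|^(-1/2) f (T⁻¹ x)` on `L²(ℝ^d)`, for an invertible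
affine map `T`. -/
def D {d : ℕ} (T : Space d ≃ᵃ[ℝ] Space d) : L2 d ≃ₗ[ℂ] L2 d :=
  (compL2 T.symm).trans (LinearEquiv.smulOfNeZero ℂ (L2 d)
    ((|LinearMap.det (T.linear : Space d →ₗ[ℝ] Space d)| ^ (-(1 / 2) : ℝ) : ℝ) : ℂ)
    (Complex.ofReal_ne_zero.mpr (Real.rpow_pos_of_pos
      (abs_pos.mpr (LinearEquiv.isUnit_det' T.linear).ne_zero) _).ne'))

/-! ### The spaces `V_j` and the properties of a multiresolution analysis -/

/-- `V_0`, the closed linear span of the translates `D_γ φ`, `γ ∈ Γ`. -/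
def V0 {d : ℕ} (Γ : Subgroup (Isom d)) (φ : L2 d) : Submodule ℂ (L2 d) :=
  (Submodule.span ℂ (Set.range fun γ : Γ => D (γ : Isom d).toAffineEquiv φ)).topologicalClosure

/-- `V_j = {f (a^j x) : f ∈ V_0}`. -/
def V {d : ℕ} (Γ : Subgroup (Isom d)) (a : GL (Fin d) ℝ) (φ : L2 d) (j : ℤ) :
    Submodule ℂ (L2 d) :=
  (V0 Γ φ).map (compL2 (matAff (a ^ j)) : L2 d →ₗ[ℂ] L2 d)

/-- `Φ = (φ_1, …, φ_n)` is a crystal scaling vector for `W`: the family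
`D_γ φ_i`, `γ ∈ Γ`, `1 ≤ i ≤ n`, is an orthonormal basis of `W`. -/
def IsScalingVector {d n : ℕ} (Γ : Subgroup (Isom d)) (W : Submodule ℂ (L2 d))
    (Φ : Fin n → L2 d) : Prop :=
  Orthonormal ℂ (fun p : Γ × Fin n => D (p.1 : Isom d).toAffineEquiv (Φ p.2)) ∧
  (Submodule.span ℂ
    (Set.range fun p : Γ × Fin n => D (p.1 : Isom d).toAffineEquiv (Φ p.2))).topologicalClosure = W

/-- `φ` vanishes almost everywhere outside a compact set. -/
def IsCompactlySupported {d : ℕ} (φ : L2 d) : Prop :=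
  ∃ K : Set (Space d), IsCompact K ∧ ∀ᵐ x : Space d, x ∉ K → φ x = 0

/-- The refinement equation `φ(x) = ∑_{γ ∈ Γ'} d_γ D_γ φ(a x)` (for almost every `x`), for some
finite set `Γ' ⊆ Γ` and some scalars `d_γ`. -/
def IsRefinable {d : ℕ} (Γ : Subgroup (Isom d)) (a : GL (Fin d) ℝ) (φ : L2 d) : Prop :=
  ∃ (Γ' : Finset Γ) (c : Γ → ℂ), ∀ᵐ x : Space d,
    φ x = ∑ γ ∈ Γ', c γ * (D (γ : Isom d).toAffineEquiv φ) (matAff a x)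

/-- The condition `|φ̂(0)|² = |L| / r`, where `φ̂(ω) = ∫ exp(-2πi x·ω) φ(x) dx`, `|L|` is the volume
of a fundamental domain of the lattice `Λ` and `r` is the order of the point group. -/
def FourierCondition {d : ℕ} (Γ : Subgroup (Isom d)) (φ : L2 d) : Prop :=
  ‖FourierTransform.fourier (φ : Space d → ℂ) 0‖ ^ 2 =
    ZLattice.covolume (lattice Γ) / (Nat.card (pointGroup Γ) : ℝ)

end CrystalMRA

end

/-!
The statements about the intersection and the union rest on one quantity: the squared norm of the
projection onto `V_0` of a dilate `D (aⁿ) f`, `n ∈ ℤ`, which is also that of the projection of `f`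
onto `V_n`. By Parseval it is the sum over `γ ∈ Γ` of `|⟨D_γ φ, D (aⁿ) f⟩|²` (`hasSum_norm_inner_D_sq`).

Discreteness of `Γ` makes the set of the `γ` that map a point of one ball into another finite
(`IsCrystalGroup.finite_closedBall`). So the point group is finite, the translation lattice is
discrete, and compactness of the fundamental domain makes it a full lattice. As `a` is expanding,
`a⁻ⁿ → 0` by Gelfand's formula (`IsAdmissible.exists_norm_zpow_neg_le`).

* For `f` of compact support and `n → -∞` the supports of the dilates shrink to the origin. Only
  finitely many terms of the sum survive and each tends to zero (`tendsto_starProjection_D`). For a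
  general `f` in all the `V_j`, approximation gives `f = 0`. Nestedness is not used.
* As `D a D_γ = D_γ' D a` with `γ' = a γ a⁻¹`, the spaces are nested if and only if `D a φ ∈ V_0`. The
  coefficients of `D a φ` vanish outside a finite set because `φ` has compact support, so this is the
  refinement equation (`isRefinable_iff_mem`).
* For `f` continuous of compact support and `n → ∞`, the inner products are
  `|det a|^(-n/2) ∫ f (a⁻ⁿ (g z + k)) conj (φ z) dz` with `g` in the point group and `k` in the lattice.
  Since `φ` has compact support and `f` is uniformly continuous, the sum behaves like
  `(r / |L|) |φ̂(0)|²` times the Riemann sum of `|f|²` over the lattice `a⁻ⁿ Λ`, and so tends to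
  `(r / |L|) |φ̂(0)|² ‖f‖²` (`tendsto_norm_starProjection_D`). The sum over the lattice is written as an
  integral with a map that rounds to the lattice, which turns the limit into dominated convergence.
  If the constant is one, the projections converge to `f` and the union is dense. Conversely, in the
  nested case density forces this convergence, and the constant has to be one.
-/

namespace CrystalMRA

open Filter Bornology

/-! ### The structure of splitting crystal groups -/

/-- An element of `Γ` that moves the points of a suitable finite set by less than a suitable `ε`
is the identity. -/
theorem IsCrystalGroup.exists_finset_dist {d : ℕ} {Γ : Subgroup (Isom d)}
    (hΓ : IsCrystalGroup Γ) :
    ∃ (I : Finset (Space d)) (ε : ℝ), 0 < ε ∧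
      ∀ γ ∈ Γ, (∀ x ∈ I, dist (γ x) x < ε) → γ = 1 := by
  have := hΓ.discrete
  let S : Set (Space d → Space d) := {f | ∃ γ ∈ Γ, f = γ}
  let o : S := ⟨id, 1, Γ.one_mem, rfl⟩
  obtain ⟨U, hU, hUo⟩ := isOpen_induced_iff.mp (isOpen_discrete ({o} : Set S))
  have hid : (id : Space d → Space d) ∈ U := by
    have : o ∈ ((↑) : S → (Space d → Space d)) ⁻¹' U := hUo ▸ Set.mem_singleton o
    exact this
  obtain ⟨I, u, hu, hIU⟩ := isOpen_pi_iff.mp hU id hid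
  have hball : ∀ x ∈ I, ∃ ε > 0, Metric.ball x ε ⊆ u x := fun x hx =>
    Metric.isOpen_iff.mp (hu x hx).1 x (hu x hx).2
  choose! r hr hru using hball
  obtain ⟨ε, hε, hεr⟩ : ∃ ε > 0, ∀ x ∈ I, ε ≤ r x := by
    rcases I.eq_empty_or_nonempty with rfl | hI
    · exact ⟨1, one_pos, by simp⟩
    · exact ⟨I.inf' hI r, (Finset.lt_inf'_iff hI).mpr hr, fun x hx => Finset.inf'_le r hx⟩
  refine ⟨I, ε, hε, fun γ hγ h => ?_⟩
  have hmem : (γ : Space d → Space d) ∈ U :=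
    hIU fun x hx => hru x hx ((h x hx).trans_le (hεr x hx))
  have h1 : (⟨γ, γ, hγ, rfl⟩ : S) ∈ ({o} : Set S) := by
    rw [← hUo]
    exact hmem
  have h2 : (γ : Space d → Space d) = id := congrArg Subtype.val (Set.mem_singleton_iff.mp h1)
  ext1 x
  exact congrFun h2 x

/-- Only finitely many elements of a crystal group move the origin by at most `R`: in the finite
product of balls that contains their values on the finite set of `exists_finset_dist`, distinct
elements are uniformly separated. -/
theorem IsCrystalGroup.finite_norm_le {d : ℕ} {Γ : Subgroup (Isom d)}
    (hΓ : IsCrystalGroup Γ) (R : ℝ) : {γ : Isom d | γ ∈ Γ ∧ ‖γ 0‖ ≤ R}.Finite := by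
  obtain ⟨I, ε, hε, hI⟩ := hΓ.exists_finset_dist
  let F : Isom d → (I → Space d) := fun γ x => γ x
  have hb : IsBounded (F '' {γ : Isom d | γ ∈ Γ ∧ ‖γ 0‖ ≤ R}) := by
    refine (IsBounded.pi (S := fun x : I => Metric.closedBall 0 (R + ‖(x : Space d)‖))
      fun x => Metric.isBounded_closedBall).subset ?_
    rintro _ ⟨γ, ⟨-, hγ⟩, rfl⟩ x -
    have : dist (γ x) (γ 0) = ‖(x : Space d)‖ := by rw [γ.dist_map, dist_zero_right]
    have h2 : ‖γ x‖ ≤ dist (γ x) (γ 0) + ‖γ 0‖ := by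
      rw [dist_eq_norm]
      simpa using norm_add_le (γ x - γ 0) (γ 0)
    rw [Metric.mem_closedBall, dist_zero_right]
    change ‖γ x‖ ≤ _
    linarith
  obtain ⟨t, ht, hcov⟩ := Metric.totallyBounded_iff.mp
    (hb.isCompact_closure.totallyBounded.subset subset_closure) (ε / 2) (half_pos hε)
  refine (ht.biUnion (t := fun y =>
    {γ : Isom d | γ ∈ Γ ∧ F γ ∈ Metric.ball y (ε / 2)}) fun y _ => ?_).subset ?_
  · refine Set.Subsingleton.finite ?_
    rintro γ ⟨hγ, hγy⟩ σ ⟨hσ, hσy⟩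
    have hd : dist (F γ) (F σ) < ε := by
      have := dist_triangle_right (F γ) (F σ) y
      rw [Metric.mem_ball] at hγy hσy
      linarith
    -- `σ⁻¹ γ` moves the points of `I` by less than `ε`, so it is the identity
    have h1 := hI (σ⁻¹ * γ) (Γ.mul_mem (Γ.inv_mem hσ) hγ) fun x hx => by
      have h2 : dist (γ x) (σ x) < ε := (dist_le_pi_dist (F γ) (F σ) ⟨x, hx⟩).trans_lt hd
      have h3 : dist (σ ((σ⁻¹ * γ) x)) (σ x) = dist ((σ⁻¹ * γ) x) x := σ.dist_map _ _
      have h4 : σ ((σ⁻¹ * γ) x) = γ x := σ.apply_symm_apply _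
      rw [← h3, h4]
      exact h2
    exact (inv_mul_eq_one.mp h1).symm
  · intro γ hγ
    obtain ⟨y, hy, hyb⟩ := Set.mem_iUnion₂.mp (hcov (Set.mem_image_of_mem F hγ))
    exact Set.mem_biUnion hy ⟨hγ.1, hyb⟩

/-- Only finitely many elements of a crystal group map a point of one ball into another. -/
theorem IsCrystalGroup.finite_closedBall {d : ℕ} {Γ : Subgroup (Isom d)}
    (hΓ : IsCrystalGroup Γ) (R R' : ℝ) :
    {γ : Γ | ∃ x : Space d, ‖x‖ ≤ R ∧ ‖(γ : Isom d) x‖ ≤ R'}.Finite := by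
  refine ((hΓ.finite_norm_le (R + R')).preimage Subtype.val_injective.injOn).subset ?_
  rintro γ ⟨x, hx, hγx⟩
  refine ⟨γ.2, ?_⟩
  have h1 : dist ((γ : Isom d) 0) ((γ : Isom d) x) = ‖x‖ := by
    rw [(γ : Isom d).dist_map, dist_zero_left]
  have h2 : ‖(γ : Isom d) 0‖ ≤ dist ((γ : Isom d) 0) ((γ : Isom d) x) + ‖(γ : Isom d) x‖ := by
    rw [dist_eq_norm]
    simpa using norm_add_le ((γ : Isom d) 0 - (γ : Isom d) x) ((γ : Isom d) x)
  linarith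

theorem mem_lattice {d : ℕ} {Γ : Subgroup (Isom d)} {k : Space d} :
    k ∈ lattice Γ ↔ AffineIsometryEquiv.constVAdd ℝ (Space d) k ∈ Γ := Iff.rfl

/-- An isometry is its linear part followed by a translation. -/
theorem isom_apply {d : ℕ} (γ : Isom d) (x : Space d) :
    γ x = γ.linearIsometryEquiv x + γ 0 := by
  have := γ.map_vadd 0 x
  simpa using this

theorem IsSplittingCrystalGroup.apply_zero_mem {d : ℕ} {Γ : Subgroup (Isom d)}
    (hΓ : IsSplittingCrystalGroup Γ) {γ : Isom d} (hγ : γ ∈ Γ) : γ 0 ∈ lattice Γ := by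
  have h1 := hΓ.split _ ⟨γ, hγ, rfl⟩
  have h2 := Γ.mul_mem hγ (Γ.inv_mem h1)
  rw [mem_lattice]
  convert h2 using 1
  rw [eq_mul_inv_iff_mul_eq]
  ext1 x
  rw [isom_apply γ x]
  simp [add_comm]

theorem IsSplittingCrystalGroup.finite_pointGroup {d : ℕ} {Γ : Subgroup (Isom d)}
    (hΓ : IsSplittingCrystalGroup Γ) : Finite (pointGroup Γ) := by
  have h := hΓ.finite_norm_le 0
  have : Finite {γ : Isom d | γ ∈ Γ ∧ ‖γ 0‖ ≤ 0} := h
  refine Finite.of_injective (β := {γ : Isom d | γ ∈ Γ ∧ ‖γ 0‖ ≤ 0})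
    (fun g => ⟨(g : Space d ≃ₗᵢ[ℝ] Space d).toAffineIsometryEquiv, hΓ.split _ g.2, by simp⟩) ?_
  intro g g' h
  ext x
  have := congrArg (fun γ : {γ : Isom d | γ ∈ Γ ∧ ‖γ 0‖ ≤ 0} => (γ : Isom d) x) h
  simpa using congrArg (fun y : Space d => y _) this

theorem IsCrystalGroup.discreteTopology_lattice {d : ℕ} {Γ : Subgroup (Isom d)}
    (hΓ : IsCrystalGroup Γ) : DiscreteTopology (lattice Γ) := by
  obtain ⟨I, ε, hε, hI⟩ := hΓ.exists_finset_dist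
  refine DiscreteTopology.of_forall_le_norm hε fun k hk => ?_
  by_contra! hlt
  have := hI _ (mem_lattice.mp k.2) fun x _ => by simpa [dist_eq_norm] using hlt
  apply hk
  ext1
  simpa using congrArg (fun γ : Isom d => γ 0) this

/-- The lattice spans `ℝ^d`: otherwise the points far away in a direction orthogonal to it could
not be reached by `Γ` from a bounded set. -/
theorem IsSplittingCrystalGroup.isZLattice {d : ℕ} {Γ : Subgroup (Isom d)}
    [DiscreteTopology (lattice Γ)]
    (hΓ : IsSplittingCrystalGroup Γ) : IsZLattice ℝ (lattice Γ) := by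
  refine ⟨?_⟩
  by_contra hne
  obtain ⟨P, hP, hcov, -⟩ := hΓ.exists_fundamentalDomain
  obtain ⟨R, hR⟩ := hP.isBounded.exists_norm_le
  have hW : (Submodule.span ℝ (lattice Γ : Set (Space d)))ᗮ ≠ ⊥ := by
    rwa [Ne, Submodule.orthogonal_eq_bot_iff]
  obtain ⟨w, hw, hw0⟩ := Submodule.exists_mem_ne_zero_of_ne_bot hW
  have hwpos : 0 < ‖w‖ := norm_pos_iff.mpr hw0
  have hx : (((|R| + 1) / ‖w‖) • w) ∈ ⋃ γ ∈ Γ, γ '' P := hcov ▸ Set.mem_univ _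
  obtain ⟨γ, hγ, p, hp, hpx⟩ := Set.mem_iUnion₂.mp hx
  have h0 : inner ℝ w (γ 0) = 0 :=
    (Submodule.mem_orthogonal' _ _).mp hw _ (Submodule.subset_span (hΓ.apply_zero_mem hγ))
  have h1 : inner ℝ w (γ p) = (|R| + 1) * ‖w‖ := by
    rw [hpx, inner_smul_right, real_inner_self_eq_norm_sq]
    field_simp
  have h2 : inner ℝ w (γ p) ≤ ‖w‖ * R := by
    rw [isom_apply γ p, inner_add_right, h0, add_zero]
    refine (real_inner_le_norm _ _).trans ?_
    rw [LinearIsometryEquiv.norm_map]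
    exact mul_le_mul_of_nonneg_left (hR p hp) (norm_nonneg _)
  nlinarith [le_abs_self R]

/-- The parametrization of a splitting crystal group by its lattice and its point group, in which
`(k, g)` stands for the map `x ↦ g x + k`. -/
noncomputable def IsSplittingCrystalGroup.equivProd {d : ℕ} {Γ : Subgroup (Isom d)}
    (hΓ : IsSplittingCrystalGroup Γ) : pointGroup Γ × lattice Γ ≃ Γ :=
  Equiv.ofBijective (fun p => ⟨AffineIsometryEquiv.constVAdd ℝ (Space d) (p.2 : Space d) *
      (p.1 : Space d ≃ₗᵢ[ℝ] Space d).toAffineIsometryEquiv,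
      Γ.mul_mem (mem_lattice.mp p.2.2) (hΓ.split _ p.1.2)⟩) <| by
    constructor
    · rintro ⟨g, k⟩ ⟨g', k'⟩ h
      have h1 : ∀ x, (k : Space d) + (g : Space d ≃ₗᵢ[ℝ] Space d) x =
          (k' : Space d) + (g' : Space d ≃ₗᵢ[ℝ] Space d) x := fun x =>
        congrArg (fun γ : Γ => (γ : Isom d) x) h
      have hk : (k : Space d) = k' := by simpa using h1 0
      have hg : (g : Space d ≃ₗᵢ[ℝ] Space d) = g' := by
        ext1 x
        simpa [hk] using h1 x
      exact Prod.ext (Subtype.ext hg) (Subtype.ext hk)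
    · rintro ⟨γ, hγ⟩
      refine ⟨⟨⟨γ.linearIsometryEquiv, γ, hγ, rfl⟩, ⟨γ 0, hΓ.apply_zero_mem hγ⟩⟩, ?_⟩
      ext1
      ext1 x
      change γ 0 + γ.linearIsometryEquiv x = γ x
      rw [isom_apply γ x, add_comm]

theorem IsSplittingCrystalGroup.equivProd_apply {d : ℕ} {Γ : Subgroup (Isom d)}
    (hΓ : IsSplittingCrystalGroup Γ) (g : pointGroup Γ) (k : lattice Γ) (x : Space d) :
    (hΓ.equivProd (g, k) : Isom d) x = (g : Space d ≃ₗᵢ[ℝ] Space d) x + k :=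
  add_comm (k : Space d) ((g : Space d ≃ₗᵢ[ℝ] Space d) x)

/-- Rounding to a lattice `L`: a measurable map to `L` that moves points by a bounded distance and
whose fibres are translates of a fundamental domain. -/
theorem exists_lattice_rounding {d : ℕ} (L : Submodule ℤ (Space d)) [DiscreteTopology L]
    [IsZLattice ℝ L] :
    ∃ (s : Space d → L) (C : ℝ), Measurable s ∧ (∀ x, ‖(s x : Space d) - x‖ ≤ C) ∧
      ∀ k, volume (s ⁻¹' {k}) = ENNReal.ofReal (ZLattice.covolume L) := by
  let b := (Module.Free.chooseBasis ℤ L).ofZLatticeBasis ℝ L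
  have hb : Submodule.span ℤ (Set.range b) = L := (Module.Free.chooseBasis ℤ L).ofZLatticeBasis_span ℝ
  have hmem : ∀ x, (ZSpan.floor b x : Space d) ∈ L := fun x => hb.le (ZSpan.floor b x).2
  let s : Space d → L := fun x => ⟨ZSpan.floor b x, hmem x⟩
  have hpre : ∀ k : L, s ⁻¹' {k} = (fun x => x - (k : Space d)) ⁻¹' ZSpan.fundamentalDomain b := by
    intro k
    ext x
    rw [Set.mem_preimage, Set.mem_preimage, Set.mem_singleton_iff]
    constructor
    · intro h
      have h1 : (ZSpan.floor b x : Space d) = k := congrArg Subtype.val h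
      rw [← h1, ← ZSpan.fract_apply]
      exact ZSpan.fract_mem_fundamentalDomain b x
    · intro h
      have h1 := (ZSpan.fract_eq_self (b := b)).mpr h
      have h2 := ZSpan.fract_add_ZSpan b (x - k) (v := (k : Space d)) (hb.ge k.2)
      rw [sub_add_cancel, h1, ZSpan.fract_apply] at h2
      exact Subtype.ext (sub_right_injective h2)
  have hdom := ZLattice.isAddFundamentalDomain (Module.Free.chooseBasis ℤ L) (volume : Measure (Space d))
  refine ⟨s, ∑ i, ‖b i‖, ?_, fun x => ?_, fun k => ?_⟩
  · refine measurable_to_countable' fun k => ?_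
    rw [hpre]
    exact (measurable_id.sub_const _) (ZSpan.fundamentalDomain_measurableSet b)
  · rw [norm_sub_rev]
    exact ZSpan.norm_fract_le b x
  · rw [hpre]
    simp only [sub_eq_add_neg]
    rw [measure_preimage_add_right,
      ZLattice.covolume_eq_measure_fundamentalDomain L volume hdom, Measure.real,
      ENNReal.ofReal_toReal]
    exact (ZSpan.fundamentalDomain_isBounded b).measure_lt_top.ne

/-! ### Expanding matrices -/

/-- In a complex Banach algebra the powers of an element with spectral radius less than one tend to
zero, by Gelfand's formula. -/
theorem tendsto_pow_of_spectrum_lt_one {A : Type*} [NormedRing A] [NormedAlgebra ℂ A]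
    [CompleteSpace A] [Nontrivial A] {b : A} (hb : ∀ z ∈ spectrum ℂ b, ‖z‖ < 1) :
    Tendsto (fun n : ℕ => b ^ n) atTop (𝓝 0) := by
  have h1 : spectralRadius ℂ b < ((1 : NNReal) : ℝ≥0∞) :=
    spectrum.spectralRadius_lt_of_forall_lt b fun z hz => by exact_mod_cast hb z hz
  obtain ⟨r, hr1, hr2⟩ := ENNReal.lt_iff_exists_nnreal_btwn.mp h1
  have hr : (r : ℝ) < 1 := by exact_mod_cast hr2
  have h2 := (spectrum.pow_nnnorm_pow_one_div_tendsto_nhds_spectralRadius b).eventually_lt_const hr1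
  refine squeeze_zero_norm' ?_ (tendsto_pow_atTop_nhds_zero_of_lt_one r.2 hr)
  filter_upwards [h2, eventually_gt_atTop 0] with n hn hn0
  have hn' : (0 : ℝ) < n := by exact_mod_cast hn0
  -- eventually `‖b ^ n‖ ≤ r ^ n`
  have h3 := (ENNReal.rpow_lt_rpow hn hn').le
  rw [← ENNReal.rpow_mul, one_div_mul_cancel hn'.ne', ENNReal.rpow_one, ENNReal.rpow_natCast] at h3
  exact_mod_cast h3

theorem matAff_apply {d : ℕ} (a : GL (Fin d) ℝ) (x : Space d) :
    matAff a x = Matrix.toEuclideanCLM (𝕜 := ℝ) (a : Matrix (Fin d) (Fin d) ℝ) x := rfl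

theorem matAff_mul {d : ℕ} (a b : GL (Fin d) ℝ) : matAff (a * b) = matAff a * matAff b := by
  ext1 x
  change matAff (a * b) x = matAff a (matAff b x)
  simp only [matAff_apply, Units.val_mul, map_mul]
  rfl

theorem matAff_one {d : ℕ} : matAff (1 : GL (Fin d) ℝ) = 1 := by
  ext1 x
  simp only [matAff_apply, Units.val_one, map_one]
  rfl

theorem matAff_inv {d : ℕ} (a : GL (Fin d) ℝ) : matAff a⁻¹ = (matAff a)⁻¹ := by
  rw [eq_inv_iff_mul_eq_one, ← matAff_mul, inv_mul_cancel, matAff_one]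

theorem matAff_add {d : ℕ} (a : GL (Fin d) ℝ) (x y : Space d) :
    matAff a (x + y) = matAff a x + matAff a y := by
  simp only [matAff_apply, map_add]

/-- The inverse powers of an expanding matrix tend to zero in operator norm. -/
theorem IsAdmissible.exists_norm_zpow_neg_le {d : ℕ} (hd : 0 < d) {Γ : Subgroup (Isom d)}
    {a : GL (Fin d) ℝ} (ha : IsAdmissible Γ a) :
    ∃ δ : ℕ → ℝ, Tendsto δ atTop (𝓝 0) ∧ (∀ n, 0 ≤ δ n) ∧
      ∀ (n : ℕ) x, ‖matAff (a ^ (-(n : ℤ))) x‖ ≤ δ n * ‖x‖ := by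
  let := Matrix.linftyOpNormedRing (n := Fin d) (α := ℂ)
  let := Matrix.linftyOpNormedAlgebra (n := Fin d) (R := ℂ) (α := ℂ)
  have : Nonempty (Fin d) := ⟨⟨0, hd⟩⟩
  -- The spectrum is taken over `ℂ`, so the powers are estimated for the complexified matrix `A`.
  let A : (Matrix (Fin d) (Fin d) ℂ)ˣ :=
    Units.map ((algebraMap ℝ ℂ).mapMatrix : Matrix (Fin d) (Fin d) ℝ →+* Matrix (Fin d) (Fin d) ℂ) a
  have hspec : ∀ z ∈ spectrum ℂ ((A⁻¹ : (Matrix (Fin d) (Fin d) ℂ)ˣ) : Matrix (Fin d) (Fin d) ℂ),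
      ‖z‖ < 1 := by
    intro z hz
    rw [← spectrum.map_inv] at hz
    have h1 : 1 < ‖z⁻¹‖ := ha.expanding z⁻¹ (Set.mem_inv.mp hz)
    rw [norm_inv] at h1
    exact (one_lt_inv_iff₀.mp h1).2
  have h1 := tendsto_pow_of_spectrum_lt_one hspec
  have hmap : ∀ (n : ℕ) i j,
      ((A⁻¹ : (Matrix (Fin d) (Fin d) ℂ)ˣ) ^ n : Matrix (Fin d) (Fin d) ℂ) i j =
      (((a ^ (-(n : ℤ)) : GL (Fin d) ℝ) : Matrix (Fin d) (Fin d) ℝ) i j : ℂ) := by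
    intro n i j
    have : (A⁻¹) ^ n = Units.map ((algebraMap ℝ ℂ).mapMatrix :
        Matrix (Fin d) (Fin d) ℝ →+* Matrix (Fin d) (Fin d) ℂ) (a ^ (-(n : ℤ))) := by
      rw [zpow_neg, zpow_natCast, map_inv, map_pow, inv_pow]
    rw [← Units.val_pow_eq_pow_val, this]
    rfl
  have h2 : Tendsto (fun n : ℕ => ((a ^ (-(n : ℤ)) : GL (Fin d) ℝ) : Matrix (Fin d) (Fin d) ℝ))
      atTop (𝓝 0) := by
    refine tendsto_pi_nhds.mpr fun i => tendsto_pi_nhds.mpr fun j => ?_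
    have h3 := ((continuous_apply_apply i j).tendsto (0 : Matrix (Fin d) (Fin d) ℂ)).comp h1
    have h4 := (Complex.continuous_re.tendsto _).comp h3
    refine h4.congr fun n => ?_
    change (((A⁻¹ : (Matrix (Fin d) (Fin d) ℂ)ˣ) ^ n : Matrix (Fin d) (Fin d) ℂ) i j).re = _
    rw [hmap, Complex.ofReal_re]
  have hcont : Continuous (Matrix.toEuclideanCLM (𝕜 := ℝ) (n := Fin d)) :=
    LinearMap.continuous_of_finiteDimensional
      (Matrix.toEuclideanCLM (𝕜 := ℝ) (n := Fin d)).toAlgEquiv.toLinearMap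
  have h5 := ((hcont.tendsto 0).comp h2).norm
  rw [map_zero, norm_zero] at h5
  exact ⟨_, h5, fun n => norm_nonneg _, fun n x => ContinuousLinearMap.le_opNorm
    (Matrix.toEuclideanCLM (𝕜 := ℝ) ((a ^ (-(n : ℤ)) : GL (Fin d) ℝ) : Matrix (Fin d) (Fin d) ℝ)) x⟩

/-! ### The unitary representation of the affine group -/

theorem coeFn_compL2 {d : ℕ} (T : Space d ≃ᵃ[ℝ] Space d) (f : L2 d) :
    compL2 T f =ᵐ[volume] fun x => f (T x) :=
  MemLp.coeFn_toLp (memLp_comp_affine T f)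

/-- The normalizing factor `|det (lin T)|^(-1/2)` of `D T`. -/
noncomputable def scale {d : ℕ} (T : Space d ≃ᵃ[ℝ] Space d) : ℝ :=
  |LinearMap.det (T.linear : Space d →ₗ[ℝ] Space d)| ^ (-(1 / 2) : ℝ)

theorem abs_det_pos {d : ℕ} (T : Space d ≃ᵃ[ℝ] Space d) :
    0 < |LinearMap.det (T.linear : Space d →ₗ[ℝ] Space d)| :=
  abs_pos.mpr (LinearEquiv.isUnit_det' T.linear).ne_zero

theorem scale_pos {d : ℕ} (T : Space d ≃ᵃ[ℝ] Space d) : 0 < scale T :=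
  Real.rpow_pos_of_pos (abs_det_pos T) _

theorem scale_mul {d : ℕ} (T S : Space d ≃ᵃ[ℝ] Space d) : scale (T * S) = scale T * scale S := by
  rw [scale, scale, scale, ← Real.mul_rpow (abs_nonneg _) (abs_nonneg _), ← abs_mul,
    ← LinearMap.det_comp]
  rfl

theorem scale_one {d : ℕ} : scale (1 : Space d ≃ᵃ[ℝ] Space d) = 1 := by
  have h := scale_mul (1 : Space d ≃ᵃ[ℝ] Space d) 1
  rw [mul_one] at h
  exact (mul_eq_left₀ (scale_pos _).ne').mp h.symm

theorem scale_inv {d : ℕ} (T : Space d ≃ᵃ[ℝ] Space d) : scale T⁻¹ = (scale T)⁻¹ := by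
  rw [← mul_eq_one_iff_eq_inv₀ (scale_pos T).ne', ← scale_mul, inv_mul_cancel, scale_one]

theorem scale_isom {d : ℕ} (γ : Isom d) : scale γ.toAffineEquiv = 1 := by
  have h := LinearIsometry.normDet_eq_one γ.linearIsometryEquiv.toLinearIsometry
  rw [LinearMap.normDet_eq_abs_det] at h
  have h' : |LinearMap.det (γ.toAffineEquiv.linear : Space d →ₗ[ℝ] Space d)| = 1 := h
  rw [scale, h', Real.one_rpow]

theorem D_apply {d : ℕ} (T : Space d ≃ᵃ[ℝ] Space d) (f : L2 d) :
    D T f = (scale T : ℂ) • compL2 T⁻¹ f := rfl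

theorem coeFn_D {d : ℕ} (T : Space d ≃ᵃ[ℝ] Space d) (f : L2 d) :
    D T f =ᵐ[volume] fun x => (scale T : ℂ) * f (T⁻¹ x) := by
  rw [D_apply]
  filter_upwards [Lp.coeFn_smul (scale T : ℂ) (compL2 T⁻¹ f), coeFn_compL2 T⁻¹ f] with x h1 h2
  rw [h1, Pi.smul_apply, h2, smul_eq_mul]

theorem D_mul {d : ℕ} (T S : Space d ≃ᵃ[ℝ] Space d) (f : L2 d) : D (T * S) f = D T (D S f) := by
  ext1
  filter_upwards [coeFn_D (T * S) f, coeFn_D T (D S f),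
    (quasiMeasurePreserving_affine T⁻¹).ae (coeFn_D S f)] with x h1 h2 h3
  rw [h1, h2, h3, scale_mul, mul_inv_rev, Complex.ofReal_mul, mul_assoc]
  rfl

theorem D_one {d : ℕ} (f : L2 d) : D 1 f = f := by
  apply (D (1 : Space d ≃ᵃ[ℝ] Space d)).injective
  rw [← D_mul, one_mul]

theorem D_inv_apply {d : ℕ} (T : Space d ≃ᵃ[ℝ] Space d) (f : L2 d) : D T⁻¹ (D T f) = f := by
  rw [← D_mul, inv_mul_cancel, D_one]

theorem D_apply_inv {d : ℕ} (T : Space d ≃ᵃ[ℝ] Space d) (f : L2 d) : D T (D T⁻¹ f) = f := by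
  rw [← D_mul, mul_inv_cancel, D_one]

theorem norm_D {d : ℕ} (T : Space d ≃ᵃ[ℝ] Space d) (f : L2 d) : ‖D T f‖ = ‖f‖ := by
  have hcomp : ‖compL2 T⁻¹ f‖ = |LinearMap.det (T.linear : Space d →ₗ[ℝ] Space d)| ^ (1 / 2 : ℝ)
      * ‖f‖ := by
    have h1 : eLpNorm (fun x => f (T⁻¹ x)) 2 volume =
        eLpNorm f 2 (ENNReal.ofReal
          |(LinearMap.det (T⁻¹.linear : Space d →ₗ[ℝ] Space d))⁻¹| • volume) :=
      eLpNorm_comp_measurePreserving ((Lp.memLp f).smul_measure ENNReal.ofReal_ne_top).1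
        (measurePreserving_affine T⁻¹)
    have hdet : (LinearMap.det (T⁻¹.linear : Space d →ₗ[ℝ] Space d))⁻¹ =
        LinearMap.det (T.linear : Space d →ₗ[ℝ] Space d) := by
      rw [inv_eq_iff_eq_inv]
      exact LinearEquiv.det_coe_symm T.linear
    rw [hdet, eLpNorm_smul_measure_of_ne_top (by norm_num)] at h1
    change ‖(memLp_comp_affine T⁻¹ f).toLp _‖ = _
    rw [Lp.norm_toLp, h1, Lp.norm_def, smul_eq_mul, ENNReal.toReal_mul, ← ENNReal.toReal_rpow,
      ENNReal.toReal_ofReal (abs_nonneg _)]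
    norm_num
  rw [D_apply, norm_smul, hcomp, Complex.norm_real, Real.norm_of_nonneg (scale_pos T).le, scale,
    ← mul_assoc, ← Real.rpow_add (abs_det_pos T)]
  norm_num

/-- The operator `D T` as a unitary operator. -/
noncomputable def unitaryD {d : ℕ} (T : Space d ≃ᵃ[ℝ] Space d) : L2 d ≃ₗᵢ[ℂ] L2 d :=
  ⟨D T, norm_D T⟩

theorem inner_D_D {d : ℕ} (T S : Space d ≃ᵃ[ℝ] Space d) (f g : L2 d) :
    inner ℂ (D T f) (D S g) = inner ℂ f (D (T⁻¹ * S) g) := by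
  have h : D S g = D T (D (T⁻¹ * S) g) := by rw [← D_mul, mul_inv_cancel_left]
  rw [h]
  exact (unitaryD T).inner_map_map _ _

theorem inner_D_D_eq_integral {d : ℕ} (γ : Isom d) (S : Space d ≃ᵃ[ℝ] Space d) (f g : L2 d) :
    inner ℂ (D γ.toAffineEquiv f) (D S g) =
      (scale S : ℂ) * ∫ z, g (S⁻¹ (γ z)) * (starRingEnd ℂ) (f z) := by
  rw [inner_D_D, L2.inner_def, ← integral_const_mul]
  refine integral_congr_ae ?_
  filter_upwards [coeFn_D (γ.toAffineEquiv⁻¹ * S) g] with z hz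
  rw [hz, scale_mul, scale_inv, scale_isom, inv_one, one_mul, RCLike.inner_apply, mul_inv_rev,
    inv_inv, mul_assoc]
  rfl

/-! ### Closed spans of orthonormal families -/

section Hilbert

variable {ι H : Type*} [NormedAddCommGroup H] [InnerProductSpace ℂ H]

theorem eq_zero_of_mem_closure_span {e : ι → H} {v : H}
    (hv : v ∈ (Submodule.span ℂ (Set.range e)).topologicalClosure)
    (h : ∀ i, inner ℂ (e i) v = 0) : v = 0 := by
  have h1 : v ∈ (Submodule.span ℂ (Set.range e))ᗮ := by
    rw [Submodule.mem_orthogonal]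
    intro u hu
    induction hu using Submodule.span_induction with
    | mem x hx => obtain ⟨i, rfl⟩ := hx; exact h i
    | zero => exact inner_zero_left _
    | add x y _ _ hx hy => rw [inner_add_left, hx, hy, add_zero]
    | smul c x _ hx => rw [inner_smul_left, hx, mul_zero]
  rw [← Submodule.orthogonal_closure] at h1
  exact inner_self_eq_zero.mp (h1 v hv)

theorem orthonormal_eq_sum_of_mem_closure_span {e : ι → H} (he : Orthonormal ℂ e) {v : H}
    (hv : v ∈ (Submodule.span ℂ (Set.range e)).topologicalClosure) (s : Finset ι)
    (h : ∀ i ∉ s, inner ℂ (e i) v = 0) : v = ∑ i ∈ s, inner ℂ (e i) v • e i := by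
  classical
  rw [← sub_eq_zero]
  refine eq_zero_of_mem_closure_span (e := e) (Submodule.sub_mem _ hv (Submodule.sum_mem _
    fun i _ => Submodule.smul_mem _ _ ?_)) fun i => ?_
  · exact Submodule.le_topologicalClosure _ (Submodule.subset_span ⟨i, rfl⟩)
  · rw [inner_sub_right]
    by_cases hi : i ∈ s
    · rw [he.inner_right_sum _ hi, sub_self]
    · rw [h i hi, inner_sum, Finset.sum_eq_zero, sub_zero]
      intro j hj
      rw [inner_smul_right, he.inner_eq_zero (fun hij : i = j => hi (hij ▸ hj)), mul_zero]

variable [CompleteSpace H]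

/-- Parseval's identity for the orthogonal projection onto the closed span of an orthonormal
family. -/
theorem orthonormal_hasSum_norm_inner_sq {e : ι → H} (he : Orthonormal ℂ e) (u : H) :
    HasSum (fun i => ‖inner ℂ (e i) u‖ ^ 2)
      (‖(Submodule.span ℂ (Set.range e)).topologicalClosure.starProjection u‖ ^ 2) := by
  set W := (Submodule.span ℂ (Set.range e)).topologicalClosure with hW
  have hmem : ∀ i, e i ∈ W := fun i =>
    Submodule.le_topologicalClosure _ (Submodule.subset_span ⟨i, rfl⟩)
  let e' : ι → W := fun i => ⟨e i, hmem i⟩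
  have he' : Orthonormal ℂ e' := by
    classical
    rw [orthonormal_iff_ite] at he ⊢
    exact he
  let b : HilbertBasis ι ℂ W := HilbertBasis.mkOfOrthogonalEqBot he' <| by
    rw [Submodule.eq_bot_iff]
    intro w hw
    ext1
    refine eq_zero_of_mem_closure_span (e := e) w.2 fun i => ?_
    exact hw (e' i) (Submodule.subset_span ⟨i, rfl⟩)
  have hb : ∀ i, b i = e' i := fun i => by rw [HilbertBasis.coe_mkOfOrthogonalEqBot]
  let w : W := W.orthogonalProjectionOnto u
  have hinner : ∀ i, inner ℂ (b i) w = inner ℂ (e i) u := fun i => by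
    rw [hb, Submodule.coe_inner]
    change inner ℂ (e i) (W.starProjection u) = _
    rw [← Submodule.inner_starProjection_left_eq_right,
      Submodule.starProjection_eq_self_iff.mpr (hmem i)]
  have hsum := b.hasSum_inner_mul_inner w w
  rw [inner_self_eq_norm_sq_to_K] at hsum
  have hre := Complex.hasSum_re hsum
  convert! hre using 1
  · ext i
    rw [← inner_conj_symm w (b i), hinner, mul_comm, Complex.mul_conj, Complex.normSq_eq_norm_sq]
    exact (Complex.ofReal_re _).symm
  · change _ = (((‖w‖ : ℝ) : ℂ) ^ 2).re
    rw [← Complex.ofReal_pow]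
    exact (Complex.ofReal_re (‖w‖ ^ 2)).symm

end Hilbert

/-! ### Supports -/

/-- `f` vanishes almost everywhere outside the closed ball of radius `R` around the origin. -/
def VanishesOutside {d : ℕ} (f : L2 d) (R : ℝ) : Prop :=
  ∀ᵐ x : Space d, R < ‖x‖ → f x = 0

theorem IsCompactlySupported.exists_vanishesOutside {d : ℕ} {f : L2 d}
    (hf : IsCompactlySupported f) : ∃ R, VanishesOutside f R := by
  obtain ⟨K, hK, h⟩ := hf
  obtain ⟨R, hR⟩ := hK.isBounded.exists_norm_le
  exact ⟨R, h.mono fun x hx hRx => hx fun hxK => (hR x hxK).not_gt hRx⟩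

theorem VanishesOutside.D_matAff {d : ℕ} {f : L2 d} {R : ℝ} (hf : VanishesOutside f R)
    (a : GL (Fin d) ℝ) {C : ℝ} (hC0 : 0 ≤ C) (hC : ∀ x, ‖matAff a x‖ ≤ C * ‖x‖) :
    VanishesOutside (D (matAff a) f) (C * R) := by
  filter_upwards [coeFn_D (matAff a) f, (quasiMeasurePreserving_affine (matAff a)⁻¹).ae hf]
    with x h1 h2 hx
  rw [h1, h2, mul_zero]
  by_contra! hle
  have h3 : matAff a ((matAff a)⁻¹ x) = x := (matAff a).apply_symm_apply x
  have h4 := hC ((matAff a)⁻¹ x)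
  rw [h3] at h4
  exact absurd (h4.trans (mul_le_mul_of_nonneg_left hle hC0)) hx.not_ge

/-- If `D_γ f` and `g` are not orthogonal, then `γ` maps some point of a ball supporting `f` into a ball
supporting `g`. -/
theorem exists_of_inner_D_ne_zero {d : ℕ} {γ : Isom d} {f g : L2 d} {R R' : ℝ}
    (hf : VanishesOutside f R) (hg : VanishesOutside g R')
    (h : inner ℂ (D γ.toAffineEquiv f) g ≠ 0) : ∃ x : Space d, ‖x‖ ≤ R ∧ ‖γ x‖ ≤ R' := by
  by_contra! hno
  apply h
  rw [L2.inner_def]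
  refine integral_eq_zero_of_ae ?_
  filter_upwards [coeFn_D γ.toAffineEquiv f, hg,
    (quasiMeasurePreserving_affine γ.toAffineEquiv⁻¹).ae hf] with x h1 h2 h3
  rw [Pi.zero_apply, h1]
  rcases lt_or_ge R ‖(γ.toAffineEquiv⁻¹ : Space d ≃ᵃ[ℝ] Space d) x‖ with hlt | hge
  · rw [h3 hlt, mul_zero, inner_zero_left]
  · have h4 := hno _ hge
    have h5 : γ ((γ.toAffineEquiv⁻¹ : Space d ≃ᵃ[ℝ] Space d) x) = x :=
      γ.toAffineEquiv.apply_symm_apply x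
    rw [h5] at h4
    rw [h2 h4, inner_zero_right]

/-- A bounded sequence in `L²` whose supports shrink to the origin tends weakly to zero. -/
theorem tendsto_inner_of_vanishesOutside {d : ℕ} (hd : 0 < d) (e : L2 d) {u : ℕ → L2 d} {C : ℝ}
    {r : ℕ → ℝ} (hu : ∀ n, ‖u n‖ ≤ C) (hr0 : ∀ n, 0 ≤ r n) (hr : Tendsto r atTop (𝓝 0))
    (hv : ∀ n, VanishesOutside (u n) (r n)) :
    Tendsto (fun n => inner ℂ e (u n)) atTop (𝓝 0) := by
  have hvol : Tendsto (fun n => volume (Metric.closedBall (0 : Space d) (r n))) atTop (𝓝 0) := by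
    have h1 : Tendsto (fun n => ENNReal.ofReal (r n ^ d) * volume (Metric.ball (0 : Space d) 1))
        atTop (𝓝 (ENNReal.ofReal (0 ^ d) * volume (Metric.ball (0 : Space d) 1))) :=
      ENNReal.Tendsto.mul_const (ENNReal.tendsto_ofReal (hr.pow d))
        (Or.inr measure_ball_lt_top.ne)
    rw [zero_pow hd.ne', ENNReal.ofReal_zero, zero_mul] at h1
    refine h1.congr fun n => ?_
    rw [Measure.addHaar_closedBall _ _ (hr0 n), finrank_euclideanSpace_fin]
  have hC : 0 ≤ C := (norm_nonneg _).trans (hu 0)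
  rw [NormedAddGroup.tendsto_nhds_zero]
  intro ε hε
  obtain ⟨η, hη, hind⟩ := (Lp.memLp e).eLpNorm_indicator_le (by norm_num) (by norm_num)
    (show 0 < ε / (C + 1) by positivity)
  filter_upwards [hvol.eventually_lt_const (ENNReal.ofReal_pos.mpr hη)] with n hn
  -- only the restriction of `e` to the shrinking ball matters, and its norm tends to zero
  set B := Metric.closedBall (0 : Space d) (r n)
  have hB : MeasurableSet B := Metric.isClosed_closedBall.measurableSet
  have hmem : MemLp (B.indicator e) 2 volume := (Lp.memLp e).indicator hB
  have hinner : inner ℂ e (u n) = inner ℂ (hmem.toLp _) (u n) := by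
    rw [L2.inner_def, L2.inner_def]
    refine integral_congr_ae ?_
    filter_upwards [hmem.coeFn_toLp, hv n] with x h1 h2
    rw [h1]
    by_cases hx : x ∈ B
    · rw [Set.indicator_of_mem hx]
    · rw [h2 (by simpa [B] using hx), inner_zero_right, inner_zero_right]
  have hnorm : ‖hmem.toLp _‖ ≤ ε / (C + 1) := by
    rw [Lp.norm_toLp]
    exact ENNReal.toReal_le_of_le_ofReal (by positivity) (hind B hB hn.le)
  rw [hinner]
  calc ‖inner ℂ (hmem.toLp _) (u n)‖ ≤ ‖hmem.toLp _‖ * ‖u n‖ := norm_inner_le_norm _ _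
    _ ≤ ε / (C + 1) * C := mul_le_mul hnorm (hu n) (norm_nonneg _) (by positivity)
    _ < ε / (C + 1) * (C + 1) := by
      have : 0 < ε / (C + 1) := by positivity
      nlinarith
    _ = ε := div_mul_cancel₀ _ (by positivity)

theorem vanishesOutside_toLp {d : ℕ} {h : Space d → ℂ} (hm : MemLp h 2 volume) {R : ℝ}
    (hR : ∀ x, R < ‖x‖ → h x = 0) : VanishesOutside (hm.toLp h) R := by
  filter_upwards [hm.coeFn_toLp] with x hx hxR
  rw [hx, hR x hxR]

/-- Continuous functions with compact support are dense in `L²(ℝ^d)`. -/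
theorem exists_continuous_norm_sub_le {d : ℕ} (f : L2 d) {ε : ℝ} (hε : 0 < ε) :
    ∃ (h : Space d → ℂ) (hm : MemLp h 2 volume), Continuous h ∧
      (∃ R, 0 ≤ R ∧ ∀ x, R < ‖x‖ → h x = 0) ∧ ‖f - hm.toLp h‖ ≤ ε := by
  obtain ⟨h, hsupp, hle, hcont, hm⟩ := (Lp.memLp f).exists_hasCompactSupport_eLpNorm_sub_le
    (by norm_num) (ENNReal.ofReal_pos.mpr hε).ne'
  refine ⟨h, hm, hcont, ?_, ?_⟩
  · obtain ⟨R, hR⟩ := hsupp.isBounded.exists_norm_le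
    refine ⟨|R|, abs_nonneg R, fun x hx => ?_⟩
    by_contra hne
    exact ((le_abs_self R).trans_lt hx).not_ge (hR x (subset_tsupport h hne))
  · have h1 : f - hm.toLp h = ((Lp.memLp f).sub hm).toLp _ := by
      rw [MemLp.toLp_sub (Lp.memLp f) hm, Lp.toLp_coeFn]
    rw [h1, Lp.norm_toLp]
    exact ENNReal.toReal_le_of_le_ofReal hε.le hle

/-! ### The spaces `V_j` -/

theorem compL2_eq {d : ℕ} (T : Space d ≃ᵃ[ℝ] Space d) (f : L2 d) :
    compL2 T f = (scale T : ℂ) • D T⁻¹ f := by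
  rw [D_apply, inv_inv, scale_inv, smul_smul, ← Complex.ofReal_mul,
    mul_inv_cancel₀ (scale_pos T).ne', Complex.ofReal_one, one_smul]

theorem scale_ne_zero {d : ℕ} (T : Space d ≃ᵃ[ℝ] Space d) : (scale T : ℂ) ≠ 0 :=
  Complex.ofReal_ne_zero.mpr (scale_pos T).ne'

section

variable {d : ℕ} {Γ : Subgroup (Isom d)} {a : GL (Fin d) ℝ} {φ : L2 d}

theorem mem_V_iff {j : ℤ} {f : L2 d} : f ∈ V Γ a φ j ↔ D (matAff (a ^ j)) f ∈ V0 Γ φ := by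
  rw [V, Submodule.mem_map]
  constructor
  · rintro ⟨h, hh, rfl⟩
    change D _ (compL2 _ h) ∈ _
    rw [compL2_eq, map_smul, D_apply_inv]
    exact Submodule.smul_mem _ _ hh
  · intro h
    refine ⟨(scale (matAff (a ^ j)) : ℂ)⁻¹ • D (matAff (a ^ j)) f, Submodule.smul_mem _ _ h, ?_⟩
    change compL2 _ _ = f
    rw [map_smul, compL2_eq, D_inv_apply, smul_smul, inv_mul_cancel₀ (scale_ne_zero _), one_smul]

theorem V_zero : V Γ a φ 0 = V0 Γ φ := by
  ext f
  rw [mem_V_iff, zpow_zero, matAff_one, D_one]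

theorem isClosed_V0 : IsClosed (V0 Γ φ : Set (L2 d)) := Submodule.isClosed_topologicalClosure _

instance : (V0 Γ φ).HasOrthogonalProjection := by
  rw [V0]
  infer_instance

theorem hasSum_norm_inner_D_sq
    (horth : Orthonormal ℂ (fun γ : Γ => D (γ : Isom d).toAffineEquiv φ)) (u : L2 d) :
    HasSum (fun γ : Γ => ‖inner ℂ (D (γ : Isom d).toAffineEquiv φ) u‖ ^ 2)
      (‖(V0 Γ φ).starProjection u‖ ^ 2) :=
  orthonormal_hasSum_norm_inner_sq horth u

theorem isClosed_V (j : ℤ) : IsClosed (V Γ a φ j : Set (L2 d)) := by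
  have h : (V Γ a φ j : Set (L2 d)) = unitaryD (matAff (a ^ j)) ⁻¹' (V0 Γ φ) := by
    ext f
    exact mem_V_iff
  rw [h]
  exact isClosed_V0.preimage (unitaryD _).continuous

theorem mem_V_add_one {j : ℤ} {f : L2 d} : f ∈ V Γ a φ (j + 1) ↔ D (matAff a) f ∈ V Γ a φ j := by
  rw [mem_V_iff, mem_V_iff, zpow_add_one, matAff_mul, D_mul]

theorem V_add_one (j : ℤ) :
    V Γ a φ (j + 1) = (V Γ a φ j).map ((D (matAff a)).symm : L2 d →ₗ[ℂ] L2 d) := by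
  ext f
  rw [mem_V_add_one, Submodule.mem_map]
  constructor
  · exact fun h => ⟨_, h, (D (matAff a)).symm_apply_apply f⟩
  · rintro ⟨g, hg, rfl⟩
    change D (matAff a) ((D (matAff a)).symm g) ∈ _
    rwa [LinearEquiv.apply_symm_apply]

theorem D_mem_V0 (γ : Γ) : D (γ : Isom d).toAffineEquiv φ ∈ V0 Γ φ :=
  Submodule.le_topologicalClosure _ (Submodule.subset_span ⟨γ, rfl⟩)

theorem self_mem_V0 : φ ∈ V0 Γ φ := by
  have h := D_mem_V0 (φ := φ) (1 : Γ)
  have h1 : ((1 : Γ) : Isom d).toAffineEquiv = 1 := rfl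
  rwa [h1, D_one] at h

/-- A unitary `D T` leaves `V0` invariant as soon as it maps the generators into `V0`. -/
theorem D_mem_V0_of_forall {T : Space d ≃ᵃ[ℝ] Space d}
    (h : ∀ γ : Γ, D T (D (γ : Isom d).toAffineEquiv φ) ∈ V0 Γ φ) {f : L2 d} (hf : f ∈ V0 Γ φ) :
    D T f ∈ V0 Γ φ := by
  have hle : V0 Γ φ ≤ (V0 Γ φ).comap (D T : L2 d →ₗ[ℂ] L2 d) := by
    refine Submodule.topologicalClosure_minimal _ (Submodule.span_le.mpr ?_)
      (isClosed_V0.preimage (unitaryD T).continuous)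
    rintro _ ⟨γ, rfl⟩
    exact h γ
  exact hle hf

theorem D_isom_mem_V0 (σ : Γ) {f : L2 d} (hf : f ∈ V0 Γ φ) :
    D (σ : Isom d).toAffineEquiv f ∈ V0 Γ φ :=
  D_mem_V0_of_forall (fun γ => by
    rw [← D_mul]
    exact D_mem_V0 (σ * γ)) hf

theorem isScalingVector
    (horth : Orthonormal ℂ (fun γ : Γ => D (γ : Isom d).toAffineEquiv φ)) :
    IsScalingVector Γ (V Γ a φ 0) (fun _ : Fin 1 => φ) := by
  refine ⟨horth.comp Prod.fst fun p q h => Prod.ext h (Subsingleton.elim _ _), ?_⟩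
  rw [V_zero, V0]
  congr 2
  ext f
  constructor
  · rintro ⟨⟨γ, i⟩, h⟩
    exact ⟨γ, h⟩
  · rintro ⟨γ, h⟩
    exact ⟨⟨γ, 0⟩, h⟩

/-- The dilates `D (a⁻ⁿ) g` of a function of compact support become orthogonal to `V_0`: their supports
shrink to the origin, so that only finitely many translates of `φ` matter, and the dilates tend weakly
to zero. -/
theorem tendsto_starProjection_D (hd : 0 < d) (hΓ : IsCrystalGroup Γ) (ha : IsAdmissible Γ a)
    (hφ : IsCompactlySupported φ)
    (horth : Orthonormal ℂ (fun γ : Γ => D (γ : Isom d).toAffineEquiv φ)) {g : L2 d} {R' : ℝ}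
    (hR' : 0 ≤ R') (hg : VanishesOutside g R') :
    Tendsto (fun n : ℕ => ‖(V0 Γ φ).starProjection (D (matAff (a ^ (-(n : ℤ)))) g)‖ ^ 2)
      atTop (𝓝 0) := by
  obtain ⟨R, hR⟩ := hφ.exists_vanishesOutside
  obtain ⟨δ, hδ, hδ0, hδa⟩ := ha.exists_norm_zpow_neg_le hd
  have hsupp : ∀ n : ℕ, VanishesOutside (D (matAff (a ^ (-(n : ℤ)))) g) (δ n * R') := fun n =>
    hg.D_matAff _ (hδ0 n) (hδa n)
  have hδR : Tendsto (fun n => δ n * R') atTop (𝓝 0) := by simpa using hδ.mul_const R'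
  have hfin := hΓ.finite_closedBall R 1
  have hsum : Tendsto (fun n : ℕ => ∑ γ ∈ hfin.toFinset,
      ‖inner ℂ (D (γ : Isom d).toAffineEquiv φ) (D (matAff (a ^ (-(n : ℤ)))) g)‖ ^ 2)
      atTop (𝓝 0) := by
    rw [← Finset.sum_const_zero (s := hfin.toFinset)]
    refine tendsto_finsetSum _ fun γ _ => ?_
    have h := tendsto_inner_of_vanishesOutside hd (D (γ : Isom d).toAffineEquiv φ)
      (C := ‖g‖) (fun n => (norm_D (matAff (a ^ (-(n : ℤ)))) g).le)
      (fun n => mul_nonneg (hδ0 n) hR') hδR hsupp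
    simpa using h.norm.pow 2
  refine hsum.congr' ?_
  filter_upwards [hδR.eventually_lt_const one_pos] with n hn
  refine (hasSum_sum_of_ne_finset_zero fun γ hγ => ?_).unique (hasSum_norm_inner_D_sq horth _)
  by_contra hne
  apply hγ
  rw [Set.Finite.mem_toFinset]
  obtain ⟨x, hx, hγx⟩ := exists_of_inner_D_ne_zero (γ := γ) hR (hsupp n)
    fun h => hne (by rw [h, norm_zero, zero_pow two_ne_zero])
  exact ⟨x, hx, hγx.trans hn.le⟩

theorem iInf_V_eq_bot (hd : 0 < d) (hΓ : IsCrystalGroup Γ) (ha : IsAdmissible Γ a)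
    (hφ : IsCompactlySupported φ)
    (horth : Orthonormal ℂ (fun γ : Γ => D (γ : Isom d).toAffineEquiv φ)) :
    (⨅ j : ℤ, V Γ a φ j) = ⊥ := by
  rw [Submodule.eq_bot_iff]
  intro f hf
  rw [Submodule.mem_iInf] at hf
  rw [← norm_le_zero_iff]
  refine le_of_forall_pos_le_add fun ε hε => ?_
  obtain ⟨h, hm, -, ⟨R', hR', hh⟩, hle⟩ := exists_continuous_norm_sub_le f hε
  have hlim := (tendsto_starProjection_D hd hΓ ha hφ horth hR'
    (vanishesOutside_toLp hm hh)).sqrt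
  simp only [Real.sqrt_sq (norm_nonneg _), Real.sqrt_zero] at hlim
  have hlim' := hlim.add_const ε
  refine ge_of_tendsto' hlim' fun n => ?_
  set T := matAff (a ^ (-(n : ℤ)))
  set P := (V0 Γ φ).starProjection
  have h1 : P (D T f) = D T f :=
    Submodule.starProjection_eq_self_iff.mpr (mem_V_iff.mp (hf _))
  calc ‖f‖ = ‖P (D T (hm.toLp h)) + P (D T (f - hm.toLp h))‖ := by
        rw [← map_add, ← map_add, add_sub_cancel, h1, norm_D]
    _ ≤ ‖P (D T (hm.toLp h))‖ + ‖P (D T (f - hm.toLp h))‖ := norm_add_le _ _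
    _ ≤ ‖P (D T (hm.toLp h))‖ + ε := by
        gcongr
        refine (Submodule.norm_starProjection_apply_le _ _).trans ?_
        rwa [norm_D]

/-! ### The refinement equation -/

theorem isRefinable_iff : IsRefinable Γ a φ ↔ ∃ (s : Finset Γ) (c : Γ → ℂ),
    D (matAff a) φ = ∑ γ ∈ s, c γ • D (γ : Isom d).toAffineEquiv φ := by
  have key : ∀ (s : Finset Γ) (c : Γ → ℂ),
      (∀ᵐ x : Space d, φ x = ∑ γ ∈ s, c γ * (D (γ : Isom d).toAffineEquiv φ) (matAff a x)) ↔
      (scale (matAff a) : ℂ)⁻¹ • D (matAff a) φ =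
        ∑ γ ∈ s, c γ • D (γ : Isom d).toAffineEquiv φ := by
    intro s c
    have h1 : (compL2 (matAff a) (∑ γ ∈ s, c γ • D (γ : Isom d).toAffineEquiv φ) : L2 d)
        =ᵐ[volume] fun x => ∑ γ ∈ s, c γ * (D (γ : Isom d).toAffineEquiv φ) (matAff a x) := by
      have h2 : ((∑ γ ∈ s, c γ • D (γ : Isom d).toAffineEquiv φ : L2 d) : Space d → ℂ)
          =ᵐ[volume] fun x => ∑ γ ∈ s, c γ * (D (γ : Isom d).toAffineEquiv φ) x := by
        refine (Lp.coeFn_finsetSum _ _).trans ?_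
        have h3 : ∀ᵐ x : Space d, ∀ γ ∈ s, (c γ • D (γ : Isom d).toAffineEquiv φ : L2 d) x =
            c γ * (D (γ : Isom d).toAffineEquiv φ) x := by
          refine (Filter.eventually_all_finset s).mpr fun γ _ => ?_
          filter_upwards [Lp.coeFn_smul (c γ) (D (γ : Isom d).toAffineEquiv φ)] with x hx
          rw [hx, Pi.smul_apply, smul_eq_mul]
        filter_upwards [h3] with x hx
        rw [Finset.sum_apply]
        exact Finset.sum_congr rfl hx
      filter_upwards [coeFn_compL2 (matAff a) (∑ γ ∈ s, c γ • D (γ : Isom d).toAffineEquiv φ),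
        (quasiMeasurePreserving_affine (matAff a)).ae h2] with x hx hx2
      rw [hx, hx2]
    rw [← (compL2 (matAff a)).injective.eq_iff, map_smul, compL2_eq _ (D _ φ), D_inv_apply,
      smul_smul, inv_mul_cancel₀ (scale_ne_zero _), one_smul, Lp.ext_iff]
    exact ⟨fun h => EventuallyEq.trans h h1.symm, fun h => EventuallyEq.trans h h1⟩
  constructor
  · rintro ⟨s, c, h⟩
    refine ⟨s, fun γ => scale (matAff a) * c γ, ?_⟩
    have h1 := congrArg (fun f => (scale (matAff a) : ℂ) • f) ((key s c).mp h)
    simp only [smul_smul, mul_inv_cancel₀ (scale_ne_zero (matAff a)), one_smul,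
      Finset.smul_sum] at h1
    exact h1
  · rintro ⟨s, c, h⟩
    refine ⟨s, fun γ => (scale (matAff a) : ℂ)⁻¹ * c γ, (key s _).mpr ?_⟩
    rw [h, Finset.smul_sum]
    simp only [smul_smul]

/-- Admissibility gives `D a D_γ = D_γ' D a` with `γ' = a γ a⁻¹ ∈ Γ`, so the spaces are nested as
soon as `D a φ` belongs to `V_0`. -/
theorem V_le_V_add_one (ha : IsAdmissible Γ a) (h : D (matAff a) φ ∈ V0 Γ φ) (j : ℤ) :
    V Γ a φ j ≤ V Γ a φ (j + 1) := by
  intro f hf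
  rw [mem_V_iff] at hf
  rw [mem_V_iff, add_comm, zpow_add, zpow_one, matAff_mul, D_mul]
  refine D_mem_V0_of_forall (fun γ => ?_) hf
  obtain ⟨γ', hγ', hconj⟩ := ha.conj_mem γ γ.2
  have hcomm : matAff a * (γ : Isom d).toAffineEquiv = γ'.toAffineEquiv * matAff a := by
    ext1 x
    change matAff a ((γ : Isom d) x) = γ' (matAff a x)
    rw [hconj, matAff_inv]
    exact congrArg (fun y => matAff a ((γ : Isom d) y)) ((matAff a).symm_apply_apply x).symm
  rw [← D_mul, hcomm, D_mul]
  exact D_isom_mem_V0 ⟨γ', hγ'⟩ h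

/-- The refinement equation is `D a φ ∈ V_0`: the expansion of `D a φ` is finite since only finitely
many translates of `φ` meet its compact support. -/
theorem isRefinable_iff_mem (hΓ : IsCrystalGroup Γ) (hφ : IsCompactlySupported φ)
    (horth : Orthonormal ℂ (fun γ : Γ => D (γ : Isom d).toAffineEquiv φ)) :
    IsRefinable Γ a φ ↔ D (matAff a) φ ∈ V0 Γ φ := by
  rw [isRefinable_iff]
  constructor
  · rintro ⟨s, c, h⟩
    rw [h]
    exact Submodule.sum_mem _ fun γ _ => Submodule.smul_mem _ _ (D_mem_V0 γ)
  · intro h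
    obtain ⟨R, hR⟩ := hφ.exists_vanishesOutside
    have hRa := hR.D_matAff a (norm_nonneg _) fun x => ContinuousLinearMap.le_opNorm
      (Matrix.toEuclideanCLM (𝕜 := ℝ) (a : Matrix (Fin d) (Fin d) ℝ)) x
    have hfin := hΓ.finite_closedBall R
      (‖Matrix.toEuclideanCLM (𝕜 := ℝ) (a : Matrix (Fin d) (Fin d) ℝ)‖ * R)
    refine ⟨hfin.toFinset, _, orthonormal_eq_sum_of_mem_closure_span horth h _ fun γ hγ => ?_⟩
    by_contra hne
    apply hγ
    rw [Set.Finite.mem_toFinset]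
    exact exists_of_inner_D_ne_zero hR hRa hne

theorem forall_V_le_iff (hΓ : IsCrystalGroup Γ) (ha : IsAdmissible Γ a)
    (hφ : IsCompactlySupported φ)
    (horth : Orthonormal ℂ (fun γ : Γ => D (γ : Isom d).toAffineEquiv φ)) :
    (∀ j : ℤ, V Γ a φ j ≤ V Γ a φ (j + 1)) ↔ IsRefinable Γ a φ := by
  rw [isRefinable_iff_mem hΓ hφ horth]
  refine ⟨fun h => ?_, V_le_V_add_one ha⟩
  have h1 := h 0 (V_zero (a := a) ▸ self_mem_V0)
  rwa [mem_V_add_one, V_zero] at h1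

end

section

variable {d : ℕ} {Γ : Subgroup (Isom d)} {a : GL (Fin d) ℝ} {φ : L2 d}

/-! ### The limit of the projections onto `V_j` -/

theorem VanishesOutside.integrable {f : L2 d} {R : ℝ} (hf : VanishesOutside f R) :
    Integrable f volume := by
  have h1 : IntegrableOn f (Metric.closedBall 0 R) volume :=
    haveI : IsFiniteMeasure (volume.restrict (Metric.closedBall (0 : Space d) R)) :=
      isFiniteMeasure_restrict.mpr measure_closedBall_lt_top.ne
    ((Lp.memLp f).restrict _).integrable (by norm_num)
  refine h1.integrable_of_ae_notMem_eq_zero ?_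
  filter_upwards [hf] with x hx hxR
  exact hx (by simpa using hxR)

theorem exists_bound {h : Space d → ℂ} (hcont : Continuous h) {R : ℝ}
    (hR : ∀ x, R < ‖x‖ → h x = 0) : ∃ M, 0 ≤ M ∧ ∀ x, ‖h x‖ ≤ M := by
  obtain ⟨M, hM⟩ := (isCompact_closedBall (0 : Space d) R).exists_bound_of_continuousOn
    hcont.continuousOn
  refine ⟨|M|, abs_nonneg M, fun x => ?_⟩
  rcases le_or_gt ‖x‖ R with hx | hx
  · exact (hM x (by simpa using hx)).trans (le_abs_self M)
  · rw [hR x hx, norm_zero]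
    exact abs_nonneg M

/-- Up to the factor `scale (matAff (a ^ n))`, the inner product of the dilate `D (aⁿ) h` with the
translate of `φ` by the map `z ↦ g z + k`. -/
noncomputable def coeff (a : GL (Fin d) ℝ) (φ : L2 d) (h : Space d → ℂ) (n : ℕ)
    (g : Space d ≃ₗᵢ[ℝ] Space d) (k : Space d) : ℂ :=
  ∫ z, h (matAff (a ^ (-(n : ℤ))) (g z + k)) * (starRingEnd ℂ) (φ z)

theorem continuous_matAff (a : GL (Fin d) ℝ) : Continuous (matAff a) :=
  (Matrix.toEuclideanCLM (𝕜 := ℝ) (a : Matrix (Fin d) (Fin d) ℝ)).continuous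

theorem matAff_zpow_neg_apply (a : GL (Fin d) ℝ) (n : ℕ) (x : Space d) :
    matAff (a ^ (-(n : ℤ))) (matAff (a ^ (n : ℤ)) x) = x := by
  rw [zpow_neg, matAff_inv]
  exact (matAff (a ^ (n : ℤ))).symm_apply_apply x

theorem enorm_inner_D_D {h : Space d → ℂ} (hm : MemLp h 2 volume)
    (hΓ : IsSplittingCrystalGroup Γ) (n : ℕ) (g : pointGroup Γ) (k : lattice Γ) :
    ‖inner ℂ (D (hΓ.equivProd (g, k) : Isom d).toAffineEquiv φ)
      (D (matAff (a ^ (n : ℤ))) (hm.toLp h))‖ₑ ^ 2 =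
    ENNReal.ofReal (scale (matAff (a ^ (n : ℤ))) ^ 2) * ‖coeff a φ h n g k‖ₑ ^ 2 := by
  set γ : Isom d := (hΓ.equivProd (g, k) : Isom d)
  set T := matAff (a ^ (n : ℤ)) with hT
  have hint : ∫ z, (hm.toLp h) (T⁻¹ (γ z)) * (starRingEnd ℂ) (φ z) = coeff a φ h n g k := by
    refine integral_congr_ae ?_
    filter_upwards [(quasiMeasurePreserving_affine (T⁻¹ * γ.toAffineEquiv)).ae hm.coeFn_toLp]
      with z hz
    have hz' : (hm.toLp h) (T⁻¹ (γ z)) = h (T⁻¹ (γ z)) := hz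
    rw [hz', zpow_neg, matAff_inv, ← hΓ.equivProd_apply]
  rw [inner_D_D_eq_integral, hint, enorm_mul, mul_pow, ENNReal.ofReal_pow (scale_pos T).le]
  congr 2
  rw [← ofReal_norm, Complex.norm_real, Real.norm_of_nonneg (scale_pos T).le]

theorem scale_sq (T : Space d ≃ᵃ[ℝ] Space d) :
    scale T ^ 2 = |(LinearMap.det (T.linear : Space d →ₗ[ℝ] Space d))⁻¹| := by
  rw [scale, ← Real.rpow_natCast, ← Real.rpow_mul (abs_nonneg _), abs_inv]
  norm_num [Real.rpow_neg_one]

/-- The Jacobian factor of the substitution by `T` is the square of the normalizing factor of `D T`. -/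
theorem lintegral_comp_affine (T : Space d ≃ᵃ[ℝ] Space d) {F : Space d → ℝ≥0∞}
    (hF : Measurable F) :
    ∫⁻ x, F (T x) = ENNReal.ofReal (scale T ^ 2) * ∫⁻ x, F x := by
  rw [scale_sq, (measurePreserving_affine T).lintegral_comp hF, lintegral_smul_measure,
    smul_eq_mul]

/-- The squared norm of the projection of `D (aⁿ) h` onto `V_0`, written as an integral by means of
a rounding map `s` to the lattice. -/
theorem ofReal_norm_starProjection_D {h : Space d → ℂ} (hm : MemLp h 2 volume)
    (hΓ : IsSplittingCrystalGroup Γ)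
    (horth : Orthonormal ℂ (fun γ : Γ => D (γ : Isom d).toAffineEquiv φ))
    [Fintype (pointGroup Γ)] [DiscreteTopology (lattice Γ)] [IsZLattice ℝ (lattice Γ)]
    {s : Space d → lattice Γ} (hs : Measurable s)
    (hvol : ∀ k, volume (s ⁻¹' {k}) = ENNReal.ofReal (ZLattice.covolume (lattice Γ)))
    (n : ℕ) :
    ENNReal.ofReal (‖(V0 Γ φ).starProjection (D (matAff (a ^ (n : ℤ))) (hm.toLp h))‖ ^ 2) *
      ENNReal.ofReal (ZLattice.covolume (lattice Γ)) =
    ∑ g : pointGroup Γ, ∫⁻ x, ‖coeff a φ h n g (s (matAff (a ^ (n : ℤ)) x))‖ₑ ^ 2 := by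
  set T := matAff (a ^ (n : ℤ))
  have hsum := hasSum_norm_inner_D_sq horth (D T (hm.toLp h))
  rw [← hsum.tsum_eq, ENNReal.ofReal_tsum_of_nonneg (fun _ => sq_nonneg _) hsum.summable]
  simp only [ENNReal.ofReal_pow (norm_nonneg _), ofReal_norm]
  rw [← hΓ.equivProd.tsum_eq, ENNReal.tsum_prod', tsum_fintype, Finset.sum_mul]
  refine Finset.sum_congr rfl fun g _ => ?_
  have hmeas : Measurable fun k : lattice Γ => ‖coeff a φ h n g k‖ₑ ^ 2 := measurable_of_countable _
  rw [lintegral_comp_affine T (F := fun y => ‖coeff a φ h n g (s y)‖ₑ ^ 2) (hmeas.comp hs),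
    ← lintegral_map hmeas hs, lintegral_countable']
  rw [tsum_congr fun k => enorm_inner_D_D hm hΓ n g k]
  simp only [Measure.map_apply hs (measurableSet_singleton _), hvol]
  rw [ENNReal.tsum_mul_left, ENNReal.tsum_mul_right, mul_assoc]

/-- Dilating by `aⁿ`, rounding to the lattice, adding a bounded vector and dilating back moves points
by at most a multiple of the norm of `a⁻ⁿ`. -/
theorem norm_rounding_sub_le {δ : ℕ → ℝ} (hδ0 : ∀ n, 0 ≤ δ n)
    (hδa : ∀ (n : ℕ) x, ‖matAff (a ^ (-(n : ℤ))) x‖ ≤ δ n * ‖x‖)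
    {s : Space d → Space d} {C R : ℝ} (hC : ∀ x, ‖s x - x‖ ≤ C) (g : Space d ≃ₗᵢ[ℝ] Space d)
    (n : ℕ) (x : Space d) {z : Space d} (hz : ‖z‖ ≤ R) :
    ‖matAff (a ^ (-(n : ℤ))) (g z + s (matAff (a ^ (n : ℤ)) x)) - x‖ ≤ δ n * (R + C) := by
  set y := matAff (a ^ (n : ℤ)) x with hy
  have h1 : matAff (a ^ (-(n : ℤ))) (g z + s y) =
      matAff (a ^ (-(n : ℤ))) (g z + (s y - y)) + x := by
    have h2 : g z + s y = (g z + (s y - y)) + y := by abel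
    rw [h2, matAff_add, hy, matAff_zpow_neg_apply]
  rw [h1, add_sub_cancel_right]
  refine (hδa n _).trans (mul_le_mul_of_nonneg_left ?_ (hδ0 n))
  refine (norm_add_le _ _).trans (add_le_add ?_ (hC y))
  rwa [g.norm_map]

theorem tendsto_coeff {h : Space d → ℂ} (hcont : Continuous h) {M : ℝ} (hM : ∀ x, ‖h x‖ ≤ M)
    {R : ℝ} (hφ : VanishesOutside φ R) {δ : ℕ → ℝ} (hδ : Tendsto δ atTop (𝓝 0))
    (hδ0 : ∀ n, 0 ≤ δ n) (hδa : ∀ (n : ℕ) x, ‖matAff (a ^ (-(n : ℤ))) x‖ ≤ δ n * ‖x‖)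
    {s : Space d → Space d} {C : ℝ} (hC : ∀ x, ‖s x - x‖ ≤ C) (g : Space d ≃ₗᵢ[ℝ] Space d)
    (x : Space d) :
    Tendsto (fun n : ℕ => coeff a φ h n g (s (matAff (a ^ (n : ℤ)) x))) atTop
      (𝓝 (h x * (starRingEnd ℂ) (∫ z, φ z))) := by
  have hint := hφ.integrable
  have hconj : AEStronglyMeasurable (fun z => (starRingEnd ℂ) (φ z)) volume :=
    Complex.continuous_conj.comp_aestronglyMeasurable hint.1
  rw [← integral_conj, ← integral_const_mul]
  refine tendsto_integral_of_dominated_convergence (fun z => M * ‖φ z‖) (fun n => ?_)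
    (hint.norm.const_mul M) (fun n => ?_) ?_
  · refine AEStronglyMeasurable.mul (Continuous.aestronglyMeasurable ?_) hconj
    exact hcont.comp ((continuous_matAff _).comp (g.continuous.add_const _))
  · refine Eventually.of_forall fun z => ?_
    rw [norm_mul, RCLike.norm_conj]
    exact mul_le_mul_of_nonneg_right (hM _) (norm_nonneg _)
  · filter_upwards [hφ] with z hz
    rcases lt_or_ge R ‖z‖ with hlt | hle
    · simp [hz hlt]
    · refine Tendsto.mul_const _ ((hcont.tendsto x).comp ?_)
      rw [tendsto_iff_norm_sub_tendsto_zero]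
      refine squeeze_zero (fun _ => norm_nonneg _)
        (fun n => norm_rounding_sub_le hδ0 hδa hC g n x hle) ?_
      simpa using hδ.mul_const (R + C)

theorem norm_coeff_le {h : Space d → ℂ} {M : ℝ} (hM : ∀ x, ‖h x‖ ≤ M)
    {R : ℝ} (hφ : VanishesOutside φ R) (n : ℕ) (g : Space d ≃ₗᵢ[ℝ] Space d) (k : Space d) :
    ‖coeff a φ h n g k‖ ≤ M * ∫ z, ‖φ z‖ := by
  rw [← integral_const_mul]
  refine norm_integral_le_of_norm_le (hφ.integrable.norm.const_mul M)
    (Eventually.of_forall fun z => ?_)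
  rw [norm_mul, RCLike.norm_conj]
  exact mul_le_mul_of_nonneg_right (hM _) (norm_nonneg _)

theorem coeff_eq_zero {h : Space d → ℂ} {R' : ℝ} (hR' : ∀ x, R' < ‖x‖ → h x = 0)
    {R : ℝ} (hφ : VanishesOutside φ R) {δ : ℕ → ℝ}
    (hδ0 : ∀ n, 0 ≤ δ n) (hδa : ∀ (n : ℕ) x, ‖matAff (a ^ (-(n : ℤ))) x‖ ≤ δ n * ‖x‖)
    {s : Space d → Space d} {C : ℝ} (hC : ∀ x, ‖s x - x‖ ≤ C) (g : Space d ≃ₗᵢ[ℝ] Space d)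
    {n : ℕ} (hn : δ n * (R + C) ≤ 1) {x : Space d} (hx : R' + 1 < ‖x‖) :
    coeff a φ h n g (s (matAff (a ^ (n : ℤ)) x)) = 0 := by
  refine integral_eq_zero_of_ae ?_
  filter_upwards [hφ] with z hz
  rw [Pi.zero_apply]
  rcases lt_or_ge R ‖z‖ with hlt | hle
  · rw [hz hlt, map_zero, mul_zero]
  · rw [hR', zero_mul]
    have h1 := (norm_rounding_sub_le hδ0 hδa hC g n x hle).trans hn
    have h2 := norm_sub_norm_le x (matAff (a ^ (-(n : ℤ))) (g z + s (matAff (a ^ (n : ℤ)) x)))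
    rw [norm_sub_rev] at h2
    linarith

/-- The integrals that represent the squared norms of the projections converge: the integrands do
so boundedly, and vanish outside a common ball. -/
theorem tendsto_lintegral_coeff {h : Space d → ℂ} (hcont : Continuous h) {R' : ℝ}
    (hR' : ∀ x, R' < ‖x‖ → h x = 0) {R : ℝ} (hφ : VanishesOutside φ R)
    {δ : ℕ → ℝ} (hδ : Tendsto δ atTop (𝓝 0))
    (hδ0 : ∀ n, 0 ≤ δ n) (hδa : ∀ (n : ℕ) x, ‖matAff (a ^ (-(n : ℤ))) x‖ ≤ δ n * ‖x‖)
    {L : Submodule ℤ (Space d)} [Countable L] {s : Space d → L} (hs : Measurable s)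
    {C : ℝ} (hC : ∀ x, ‖(s x : Space d) - x‖ ≤ C) (g : Space d ≃ₗᵢ[ℝ] Space d) :
    Tendsto (fun n : ℕ => ∫⁻ x, ‖coeff a φ h n g (s (matAff (a ^ (n : ℤ)) x))‖ₑ ^ 2) atTop
      (𝓝 (∫⁻ x, ‖h x * (starRingEnd ℂ) (∫ z, φ z)‖ₑ ^ 2)) := by
  obtain ⟨M, hM0, hM⟩ := exists_bound hcont hR'
  set B := Metric.closedBall (0 : Space d) (R' + 1) with hB
  have hδC : Tendsto (fun n => δ n * (R + C)) atTop (𝓝 0) := by simpa using hδ.mul_const (R + C)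
  refine tendsto_lintegral_filter_of_dominated_convergence
    (B.indicator fun _ => ENNReal.ofReal (M * ∫ z, ‖φ z‖) ^ 2) ?_ ?_ ?_ ?_
  · refine Eventually.of_forall fun n => ?_
    have hmeas : Measurable fun k : L => ‖coeff a φ h n g k‖ₑ ^ 2 := measurable_of_countable _
    exact hmeas.comp (hs.comp (continuous_matAff _).measurable)
  · filter_upwards [hδC.eventually_lt_const one_pos] with n hn
    refine Eventually.of_forall fun x => ?_
    by_cases hx : x ∈ B
    · rw [Set.indicator_of_mem hx, ← ofReal_norm]
      gcongr
      exact norm_coeff_le hM hφ n g _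
    · have h1 : R' + 1 < ‖x‖ := by simpa [hB] using hx
      rw [coeff_eq_zero (s := fun x => (s x : Space d)) hR' hφ hδ0 hδa hC g hn.le h1, enorm_zero,
        zero_pow two_ne_zero]
      exact zero_le
  · rw [lintegral_indicator_const Metric.isClosed_closedBall.measurableSet]
    exact ENNReal.mul_ne_top (ENNReal.pow_ne_top ENNReal.ofReal_ne_top)
      measure_closedBall_lt_top.ne
  · refine Eventually.of_forall fun x => ?_
    have h1 := tendsto_coeff (s := fun x => (s x : Space d)) hcont hM hφ hδ hδ0 hδa hC g x
    exact ((ENNReal.continuous_pow 2).tendsto _).comp h1.enorm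

theorem lintegral_enorm_sq {h : Space d → ℂ} (hm : MemLp h 2 volume) :
    ∫⁻ x, ‖h x‖ₑ ^ 2 = ENNReal.ofReal (‖hm.toLp h‖ ^ 2) := by
  have h1 : ENNReal.ofReal ‖hm.toLp h‖ = eLpNorm h 2 volume := by
    rw [Lp.norm_toLp, ENNReal.ofReal_toReal hm.2.ne]
  rw [ENNReal.ofReal_pow (norm_nonneg _), h1,
    eLpNorm_eq_lintegral_rpow_enorm_toReal (by norm_num) (by norm_num), ← ENNReal.rpow_natCast,
    ← ENNReal.rpow_mul]
  norm_num

/-- The number `r |φ̂(0)|² / |L|`, which is the fraction of the squared norm of a function that is left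
by its projection onto `V_j` in the limit `j → ∞`. -/
noncomputable def captureRatio (Γ : Subgroup (Isom d)) (φ : L2 d) : ℝ :=
  (Nat.card (pointGroup Γ) : ℝ) / ZLattice.covolume (lattice Γ) * ‖∫ z, φ z‖ ^ 2

/-- The squared norms of the projections of a continuous function `h` of compact support onto `V_n`,
here transported to `V_0`, converge: they are Riemann sums of `|h|²` over the lattices
`a⁻ⁿ Λ`, up to the factor `r |φ̂(0)|² / |L|`. -/
theorem tendsto_norm_starProjection_D (hd : 0 < d) (hΓ : IsSplittingCrystalGroup Γ)
    (ha : IsAdmissible Γ a) (hφ : IsCompactlySupported φ)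
    (horth : Orthonormal ℂ (fun γ : Γ => D (γ : Isom d).toAffineEquiv φ))
    {h : Space d → ℂ} (hm : MemLp h 2 volume) (hcont : Continuous h) {R' : ℝ}
    (hR' : ∀ x, R' < ‖x‖ → h x = 0) :
    Tendsto (fun n : ℕ => ‖(V0 Γ φ).starProjection (D (matAff (a ^ (n : ℤ))) (hm.toLp h))‖ ^ 2)
      atTop (𝓝 (captureRatio Γ φ * ‖hm.toLp h‖ ^ 2)) := by
  have := hΓ.discreteTopology_lattice
  have := hΓ.isZLattice
  have := hΓ.finite_pointGroup
  have := Fintype.ofFinite (pointGroup Γ)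
  obtain ⟨δ, hδ, hδ0, hδa⟩ := ha.exists_norm_zpow_neg_le hd
  obtain ⟨R, hR⟩ := hφ.exists_vanishesOutside
  obtain ⟨s, C, hs, hC, hvol⟩ := exists_lattice_rounding (lattice Γ)
  have hcov : 0 < ZLattice.covolume (lattice Γ) := ZLattice.covolume_pos (lattice Γ) volume
  -- the limit of the squared norms, multiplied by the covolume and taken in `ℝ≥0∞`
  have h1 := tendsto_finsetSum Finset.univ fun (g : pointGroup Γ) _ =>
    tendsto_lintegral_coeff hcont hR' hR hδ hδ0 hδa hs hC (g : Space d ≃ₗᵢ[ℝ] Space d)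
  simp only [← ofReal_norm_starProjection_D hm hΓ horth hs hvol, Finset.sum_const, Finset.card_univ,
    ← Nat.card_eq_fintype_card, enorm_mul, mul_pow] at h1
  rw [lintegral_mul_const' _ _ (ENNReal.pow_ne_top enorm_ne_top), lintegral_enorm_sq hm,
    ← ofReal_norm, RCLike.norm_conj, ← ENNReal.ofReal_pow (norm_nonneg _),
    ← ENNReal.ofReal_mul (sq_nonneg _), nsmul_eq_mul, ← ENNReal.ofReal_natCast,
    ← ENNReal.ofReal_mul (Nat.cast_nonneg _)] at h1
  simp only [← ENNReal.ofReal_mul (sq_nonneg _)] at h1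
  have h2 := (ENNReal.tendsto_toReal ENNReal.ofReal_ne_top).comp h1
  rw [ENNReal.toReal_ofReal (by positivity)] at h2
  have h3 := h2.div_const (ZLattice.covolume (lattice Γ))
  convert h3 using 2 with n
  · rw [Function.comp_apply, ENNReal.toReal_ofReal (by positivity), mul_div_cancel_right₀ _ hcov.ne']
  · rw [captureRatio]
    ring

/-- At the origin the Fourier transform is the plain integral. -/
theorem fourierCondition_iff (hΓ : IsSplittingCrystalGroup Γ) :
    FourierCondition Γ φ ↔ captureRatio Γ φ = 1 := by
  have := hΓ.discreteTopology_lattice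
  have := hΓ.isZLattice
  have := hΓ.finite_pointGroup
  have hcov : 0 < ZLattice.covolume (lattice Γ) := ZLattice.covolume_pos (lattice Γ) volume
  have hr : (0 : ℝ) < Nat.card (pointGroup Γ) := by exact_mod_cast Nat.card_pos
  have hfour : FourierTransform.fourier (φ : Space d → ℂ) 0 = ∫ z, φ z := by
    rw [Real.fourier_eq]
    simp
  rw [FourierCondition, captureRatio, hfour, div_mul_eq_mul_div, div_eq_one_iff_eq hcov.ne',
    eq_div_iff hr.ne', mul_comm]

/-! ### Density of the union -/

/-- If the projections onto `V_n` preserve asymptotically the norms of the continuous functions with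
compact support, then by Pythagoras these functions are limits of their projections. -/
theorem dense_of_captureRatio_eq_one (hd : 0 < d) (hΓ : IsSplittingCrystalGroup Γ)
    (ha : IsAdmissible Γ a) (hφ : IsCompactlySupported φ)
    (horth : Orthonormal ℂ (fun γ : Γ => D (γ : Isom d).toAffineEquiv φ))
    (hone : captureRatio Γ φ = 1) : Dense (⋃ j : ℤ, (V Γ a φ j : Set (L2 d))) := by
  rw [Metric.dense_iff]
  intro f ε hε
  obtain ⟨h, hm, hcont, ⟨R', -, hR'⟩, hle⟩ := exists_continuous_norm_sub_le f (half_pos hε)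
  have hlim := tendsto_norm_starProjection_D hd hΓ ha hφ horth hm hcont hR'
  rw [hone, one_mul] at hlim
  have hgt : ‖hm.toLp h‖ ^ 2 - (ε / 2) ^ 2 < ‖hm.toLp h‖ ^ 2 := by
    have : 0 < (ε / 2) ^ 2 := by positivity
    linarith
  obtain ⟨n, hn⟩ := (hlim.eventually_const_lt hgt).exists
  set T := matAff (a ^ (n : ℤ)) with hT
  set u := D T (hm.toLp h) with hu
  set P := (V0 Γ φ).starProjection
  have hmem : D T⁻¹ (P u) ∈ V Γ a φ n := by
    rw [mem_V_iff, ← hT, D_apply_inv]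
    exact Submodule.starProjection_apply_mem _ _
  have hpyth : ‖u‖ ^ 2 = ‖P u‖ ^ 2 + ‖u - P u‖ ^ 2 := by
    have h1 : inner ℂ (P u) (u - P u) = 0 :=
      Submodule.inner_right_of_mem_orthogonal (Submodule.starProjection_apply_mem _ _)
        (Submodule.sub_starProjection_mem_orthogonal u)
    have h2 := norm_add_sq_eq_norm_sq_add_norm_sq_of_inner_eq_zero (P u) (u - P u) h1
    rw [add_sub_cancel] at h2
    simpa [sq] using h2
  have hdist : ‖hm.toLp h - D T⁻¹ (P u)‖ < ε / 2 := by
    have h1 : ‖hm.toLp h - D T⁻¹ (P u)‖ = ‖u - P u‖ := by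
      rw [← norm_D T, map_sub, D_apply_inv]
    have h2 : ‖u‖ = ‖hm.toLp h‖ := norm_D _ _
    rw [h1]
    refine lt_of_pow_lt_pow_left₀ 2 (half_pos hε).le ?_
    rw [h2] at hpyth
    linarith
  refine ⟨D T⁻¹ (P u), ?_, Set.mem_iUnion.mpr ⟨n, hmem⟩⟩
  rw [Metric.mem_ball, dist_comm, dist_eq_norm]
  calc ‖f - D T⁻¹ (P u)‖ ≤ ‖f - hm.toLp h‖ + ‖hm.toLp h - D T⁻¹ (P u)‖ :=
        norm_sub_le_norm_sub_add_norm_sub _ _ _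
    _ < ε / 2 + ε / 2 := add_lt_add_of_le_of_lt hle hdist
    _ = ε := add_halves ε

/-- If the spaces are nested with dense union, then the projections onto them converge strongly to
the identity, so no energy is lost. -/
theorem captureRatio_eq_one_of_dense (hd : 0 < d) (hΓ : IsSplittingCrystalGroup Γ)
    (ha : IsAdmissible Γ a) (hφ : IsCompactlySupported φ)
    (horth : Orthonormal ℂ (fun γ : Γ => D (γ : Isom d).toAffineEquiv φ))
    (hnest : ∀ j : ℤ, V Γ a φ j ≤ V Γ a φ (j + 1))
    (hdense : Dense (⋃ j : ℤ, (V Γ a φ j : Set (L2 d)))) : captureRatio Γ φ = 1 := by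
  have hφ1 : ‖φ‖ = 1 := by
    have := horth.1 1
    rwa [norm_D] at this
  obtain ⟨h, hm, hcont, ⟨R', -, hR'⟩, hle⟩ := exists_continuous_norm_sub_le φ one_half_pos
  have hpos : 0 < ‖hm.toLp h‖ := by
    have := norm_sub_norm_le φ (hm.toLp h)
    linarith
  set f := hm.toLp h
  have hlim := tendsto_norm_starProjection_D hd hΓ ha hφ horth hm hcont hR'
  set P := (V0 Γ φ).starProjection
  have hlim2 : Tendsto (fun n : ℕ => ‖P (D (matAff (a ^ (n : ℤ))) f)‖) atTop (𝓝 ‖f‖) := by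
    rw [Metric.tendsto_atTop]
    intro ε hε
    obtain ⟨v, hvball, hv⟩ := Metric.dense_iff.mp hdense f (ε / 2) (half_pos hε)
    obtain ⟨j, hj⟩ := Set.mem_iUnion.mp hv
    refine ⟨j.toNat, fun n hn => ?_⟩
    have hjn : j ≤ n := (Int.self_le_toNat j).trans (by exact_mod_cast hn)
    have hvn : v ∈ V Γ a φ n := monotone_int_of_le_succ hnest hjn hj
    have hPv : P (D (matAff (a ^ (n : ℤ))) v) = D (matAff (a ^ (n : ℤ))) v :=
      Submodule.starProjection_eq_self_iff.mpr (mem_V_iff.mp hvn)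
    set T := matAff (a ^ (n : ℤ))
    have hvf : ‖f - v‖ < ε / 2 := by rwa [Metric.mem_ball, dist_comm, dist_eq_norm] at hvball
    have h1 : ‖P (D T f)‖ ≤ ‖f‖ :=
      (Submodule.norm_starProjection_apply_le _ _).trans (norm_D T f).le
    have h2 : ‖D T v‖ ≤ ‖P (D T f)‖ + ‖f - v‖ := by
      have h3 : D T v = P (D T f) - P (D T (f - v)) := by
        rw [← map_sub, ← map_sub, sub_sub_cancel, hPv]
      rw [h3]
      refine (norm_sub_le _ _).trans (add_le_add_right ?_ _)
      exact (Submodule.norm_starProjection_apply_le _ _).trans (norm_D T _).le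
    rw [norm_D] at h2
    have h3 := norm_sub_norm_le f v
    rw [Real.dist_eq, abs_sub_lt_iff]
    constructor <;> linarith
  have heq := tendsto_nhds_unique hlim (hlim2.pow 2)
  exact (mul_eq_right₀ (pow_pos hpos 2).ne').mp heq

end

end CrystalMRA

theorem theorem3p8 (d : ℕ) (hd : 0 < d)
    (Γ : Subgroup (CrystalMRA.Isom d)) (hΓ : CrystalMRA.IsSplittingCrystalGroup Γ)
    (a : GL (Fin d) ℝ) (ha : CrystalMRA.IsAdmissible Γ a)
    (φ : CrystalMRA.L2 d) (hφ : CrystalMRA.IsCompactlySupported φ)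
    (horth : Orthonormal ℂ (fun γ : Γ => CrystalMRA.D (γ : CrystalMRA.Isom d).toAffineEquiv φ)) :
    -- (1) closed subspaces, dilation property, scaling function of multiplicity one, intersection
    ((∀ j : ℤ, IsClosed (CrystalMRA.V Γ a φ j : Set (CrystalMRA.L2 d))) ∧
      (∀ j : ℤ, CrystalMRA.V Γ a φ (j + 1) =
        (CrystalMRA.V Γ a φ j).map
          ((CrystalMRA.D (CrystalMRA.matAff a)).symm :
            CrystalMRA.L2 d →ₗ[ℂ] CrystalMRA.L2 d)) ∧
      CrystalMRA.IsScalingVector Γ (CrystalMRA.V Γ a φ 0) (fun _ : Fin 1 => φ) ∧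
      (⨅ j : ℤ, CrystalMRA.V Γ a φ j) = ⊥) ∧
    -- (2) nestedness is equivalent to a finite refinement equation
    ((∀ j : ℤ, CrystalMRA.V Γ a φ j ≤ CrystalMRA.V Γ a φ (j + 1)) ↔
      CrystalMRA.IsRefinable Γ a φ) ∧
    -- (3) density of the union
    ((CrystalMRA.FourierCondition Γ φ →
        Dense (⋃ j : ℤ, (CrystalMRA.V Γ a φ j : Set (CrystalMRA.L2 d)))) ∧
      (CrystalMRA.IsRefinable Γ a φ →
        (Dense (⋃ j : ℤ, (CrystalMRA.V Γ a φ j : Set (CrystalMRA.L2 d))) ↔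
          CrystalMRA.FourierCondition Γ φ))) := by
  have hdense := CrystalMRA.dense_of_captureRatio_eq_one hd hΓ ha hφ horth
  have hnest := CrystalMRA.forall_V_le_iff hΓ.toIsCrystalGroup ha hφ horth
  rw [CrystalMRA.fourierCondition_iff hΓ]
  exact ⟨⟨CrystalMRA.isClosed_V, CrystalMRA.V_add_one, CrystalMRA.isScalingVector horth,
      CrystalMRA.iInf_V_eq_bot hd hΓ.toIsCrystalGroup ha hφ horth⟩, hnest, hdense, fun href =>
    ⟨CrystalMRA.captureRatio_eq_one_of_dense hd hΓ ha hφ horth (hnest.mpr href), hdense⟩⟩
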